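/- Let $n\ge 1$, and let $(r^1,\dots,r^n,\eta^1,\dots,\eta^n)$ be the coordinates (in Jordan-block form) of the polychromatic reduction of El's kinetic equation. Let $U\subset\mathbb R^{2n}$ be an open set such that, for each $i$ and each fixed value of $\eta^i$, the set of values taken by $r^i$ on $U$ is connected. Let $\epsilon^{ij}=\epsilon^{ij}(\eta^i,\eta^j)$ ($i\ne j$) be smooth with $\epsilon^{ij}=\epsilon^{ji}$ (for the reduction with interaction kernel $G$, $\epsilon^{ij}=G(\eta^i,\eta^j)$ with $G$ symmetric), let $s_i=s_i(\eta^i)$ be smooth and nowhere zero, and let $g_i=g_i(r^i,\eta^i)$ be smooth, all on $U$. Let $\hat\epsilon$ be the symmetric $n\times n$ matrix with off-diagonal entries $\epsilon^{ij}$ and diagonal entries $\hat\epsilon^{ii}=r^i$, put $\beta=-\hat\epsilon^{-1}$ and $u^i=\sum_{k}\beta_{ki}$, and consider, at the points of $U$ where $\det\hat\epsilon\neq0$ and all $u^i\ne 0$, the semi-Riemannian metric $g$ whose contravariant components are block diagonal with the blocks $$\begin{pmatrix} m_i & n_i\\ n_i & 0\end{pmatrix},\qquad n_i=\frac{s_i}{(u^i)^2},\qquad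 m_i=-\frac{2s_i}{(u^i)^3}\sum_{j\ne i}u^j\,\frac{\partial\epsilon^{ji}}{\partial\eta^i}+\frac{g_i}{(u^i)^2}$$ in the coordinates $(r^i,\eta^i)$, $i=1,\dots,n$. Suppose that $g$ has constant curvature $c$, that is, $R^a_{\ bde}=c(\delta^a_d\,g_{be}-\delta^a_e\,g_{bd})$ for all indices, where $R^a_{\ bde}=\partial_d\Gamma^a_{be}-\partial_e\Gamma^a_{bd}+\Gamma^a_{dt}\Gamma^t_{be}-\Gamma^a_{et}\Gamma^t_{bd}$ and $\Gamma$ are the Christoffel symbols of $g$. Then each $g_i$ is quadratic in $r^i$: there are functions $\varphi_i,\chi_i,\psi_i$ of $\eta^i$ with $$g_i(r^i,\eta^i)=\varphi_i(\eta^i)(r^i)^2+\chi_i(\eta^i)\,r^i+\psi_i(\eta^i)$$ on $U$, and at all points of $U$ $$\epsilon^{ij}(\chi_i+\chi_j)-2c=2\Big(s_i\frac{\partial\epsilon^{ij}}{\partial\eta^i}+s_j\frac{\partial\epsilon^{ij}}{\partial\eta^j}+\sum_{k\neq i,j}\epsilon^{ik}\epsilon^{jk}\varphi_k\Big)\qquad(i\ne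 j),$$ $$\sum_{k\ne i}\varphi_k(\epsilon^{ik})^2+\psi_i=-c\qquad(1\le i\le n).$$ -/

import Mathlib

open scoped ContDiff

noncomputable section

namespace SolitonGas

/-! ### Coordinate expressions of semi-Riemannian geometry -/

section Geometry

variable {ι : Type*} [Fintype ι] [DecidableEq ι]

/-- The partial derivative `∂f/∂x^a` at `x`. -/
def partialDeriv (a : ι) (f : (ι → ℝ) → ℝ) (x : ι → ℝ) : ℝ :=
  fderiv ℝ f x (Pi.single a 1)

/-- The Christoffel symbol `Γ^i_{jk}` of the Levi-Civita connection of the metric `g_{ij}`. -/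
def christoffel (g : (ι → ℝ) → Matrix ι ι ℝ) (i j k : ι) (x : ι → ℝ) : ℝ :=
  (1 / 2) * ∑ t, (g x)⁻¹ i t *
    (partialDeriv k (fun y => g y t j) x + partialDeriv j (fun y => g y t k) x
      - partialDeriv t (fun y => g y j k) x)

/-- The curvature tensor
`R^i_{jkl} = Γ^i_{jl,k} - Γ^i_{jk,l} + Γ^i_{ks} Γ^s_{jl} - Γ^i_{ls} Γ^s_{jk}`. -/
def riemann (g : (ι → ℝ) → Matrix ι ι ℝ) (i j k l : ι) (x : ι → ℝ) : ℝ :=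
  partialDeriv k (christoffel g i j l) x - partialDeriv l (christoffel g i j k) x
    + ∑ t, (christoffel g i k t x * christoffel g t j l x
        - christoffel g i l t x * christoffel g t j k x)

/-- The metric `g_{ij}` has constant curvature `c` on `V`:
`R^i_{jkl} = c (δ^i_k g_{jl} - δ^i_l g_{jk})`. -/
def HasConstantCurvatureOn (g : (ι → ℝ) → Matrix ι ι ℝ) (c : ℝ) (V : Set (ι → ℝ)) : Prop :=
  ∀ x ∈ V, ∀ i j k l : ι,
    riemann g i j k l x =
      c * ((1 : Matrix ι ι ℝ) i k * g x j l - (1 : Matrix ι ι ℝ) i l * g x j k)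

end Geometry

/-! ### The reduced system in the coordinates `(r, η)` -/

/-- The space of the `2n` field variables: `x (0, i)` is `r^i` and `x (1, i)` is `η^i`. -/
abbrev Point (n : ℕ) : Type := Fin 2 × Fin n → ℝ

/-- The coordinate `r^i`. -/
abbrev Point.r {n : ℕ} (x : Point n) (i : Fin n) : ℝ := x (0, i)

/-- The coordinate `η^i`. -/
abbrev Point.eta {n : ℕ} (x : Point n) (i : Fin n) : ℝ := x (1, i)

variable {n : ℕ}

/-- The value `ε^{ij}(η^i, η^j)`. In the reduction of the kinetic equation with kernel `G`,
`ε i j = G` for all `i ≠ j`. -/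
def eps (ε : Fin n → Fin n → ℝ → ℝ → ℝ) (i j : Fin n) (x : Point n) : ℝ :=
  ε i j (x.eta i) (x.eta j)

/-- The partial derivative of `ε^{ij}(η^i, η^j)` with respect to `η^i`. -/
def epsD₁ (ε : Fin n → Fin n → ℝ → ℝ → ℝ) (i j : Fin n) (x : Point n) : ℝ :=
  deriv (fun t => ε i j t (x.eta j)) (x.eta i)

/-- The partial derivative of `ε^{ij}(η^i, η^j)` with respect to `η^j`. -/
def epsD₂ (ε : Fin n → Fin n → ℝ → ℝ → ℝ) (i j : Fin n) (x : Point n) : ℝ :=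
  deriv (fun t => ε i j (x.eta i) t) (x.eta j)

/-- The matrix with off-diagonal entries `ε^{ij}` and diagonal entries `r^i`. -/
def epsHat (ε : Fin n → Fin n → ℝ → ℝ → ℝ) (x : Point n) : Matrix (Fin n) (Fin n) ℝ :=
  Matrix.of fun i j => if i = j then x.r i else eps ε i j x

/-- `β`, minus the inverse of `epsHat`. -/
def beta (ε : Fin n → Fin n → ℝ → ℝ → ℝ) (x : Point n) : Matrix (Fin n) (Fin n) ℝ :=
  -(epsHat ε x)⁻¹

/-- The weights `u^i = ∑_k β_{ki}` as functions of `(r, η)`. -/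
def u (ε : Fin n → Fin n → ℝ → ℝ → ℝ) (i : Fin n) (x : Point n) : ℝ :=
  ∑ k, beta ε x k i

/-- The entry `n_i = s_i(η^i) / (u^i)^2`. -/
def nEntry (ε : Fin n → Fin n → ℝ → ℝ → ℝ) (s : Fin n → ℝ → ℝ) (i : Fin n) (x : Point n) : ℝ :=
  s i (x.eta i) / u ε i x ^ 2

/-- The entry `m_i = -(2 s_i / (u^i)^3) ∑_{j ≠ i} u^j ε^{ji}_{,η^i} + g_i(r^i, η^i) / (u^i)^2`. -/
def mEntry (ε : Fin n → Fin n → ℝ → ℝ → ℝ) (s : Fin n → ℝ → ℝ) (g : Fin n → ℝ → ℝ → ℝ)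
    (i : Fin n) (x : Point n) : ℝ :=
  -(2 * s i (x.eta i) / u ε i x ^ 3) * (∑ j with j ≠ i, u ε j x * epsD₂ ε j i x)
    + g i (x.r i) (x.eta i) / u ε i x ^ 2

/-- The contravariant metric `g^{ij}`: block diagonal, the `i`-th block being the Hankel matrix
`(m_i, n_i; n_i, 0)` in the coordinates `(r^i, η^i)`. -/
def contravariantMetric (ε : Fin n → Fin n → ℝ → ℝ → ℝ) (s : Fin n → ℝ → ℝ)
    (g : Fin n → ℝ → ℝ → ℝ) (x : Point n) : Matrix (Fin 2 × Fin n) (Fin 2 × Fin n) ℝ :=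
  Matrix.blockDiagonal fun i =>
    !![mEntry ε s g i x, nEntry ε s i x; nEntry ε s i x, 0]

/-- The metric `g_{ij}`, the inverse of `g^{ij}`. -/
def metric (ε : Fin n → Fin n → ℝ → ℝ → ℝ) (s : Fin n → ℝ → ℝ)
    (g : Fin n → ℝ → ℝ → ℝ) (x : Point n) : Matrix (Fin 2 × Fin n) (Fin 2 × Fin n) ℝ :=
  (contravariantMetric ε s g x)⁻¹

/-- The points at which the formulas for `β`, `n_i` and `m_i` make sense: `epsHat` is invertible
and no `u^i` vanishes. -/
def regularLocus (ε : Fin n → Fin n → ℝ → ℝ → ℝ) : Set (Point n) :=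
  {x | (epsHat ε x).det ≠ 0 ∧ ∀ i, u ε i x ≠ 0}

end SolitonGas

end

open scoped ContDiff Topology

noncomputable section

namespace SolitonGas

set_option linter.unusedSectionVars false

/-! ### Calculus of partial derivatives -/

section PartialDerivatives

variable {ι : Type*} [Fintype ι] [DecidableEq ι]

/-! Write e for `epsHat`, so β = -e⁻¹. Let D, D₁, D₂ be the diagonal matrices of g_i and its first
and second r^i-derivatives, Q the matrix with off-diagonal entries s_i ∂ε^{ij}/∂η^i and zero
diagonal, and J the all-ones matrix. Only the curvature components with indices (η^i; η^j, r^j, η^i)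
are needed. Differentiating eβ = -1 expresses all derivatives of β and u through β, u and ε, and the
components are then computed in `riemann_diag` and `riemann_offDiag`. Since u is the vector of row
sums of β, constant curvature says that on the regular locus βDβ + β(Q + Qᵀ)β + (D₁β + βD₁)/2 + D₂/2
= -c βJβ.

Multiplying by e on both sides removes every inverse (`structure_eq_of_regular`): D + Q + Qᵀ - (eD₁
+ D₁e)/2 + eD₂e/2 = -cJ. Both sides make sense on all of U. Adding the same small t ≠ 0 to every r^i
leads into the regular locus (`eventually_shift_regular`), so the identity extends to U by
continuity (`structure_eq`).

The (i,i) entry is g_i - r g_i' + r² g_i''/2 plus terms free of r = r^i. Its r^i-derivative is r²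
g_i'''/2 = 0, hence g_i''' = 0, at r^i = 0 by continuity (`deriv_three_eq_zero`). Therefore g_i''/2,
g_i' - r g_i'' and g_i - r g_i' + r² g_i''/2 are locally constant in r^i, and the connectedness
hypothesis makes them functions φ_i, χ_i, ψ_i of η^i alone. The diagonal and off-diagonal entries of
the matrix identity are then the two asserted systems. -/

/-- `f` is differentiable at `x` and its partial derivative in the direction `a` is `d`. -/
def HasPartialDerivAt (f : (ι → ℝ) → ℝ) (a : ι) (d : ℝ) (x : ι → ℝ) : Prop :=
  DifferentiableAt ℝ f x ∧ partialDeriv a f x = d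

variable {f f₁ f₂ : (ι → ℝ) → ℝ} {a : ι} {d d₁ d₂ : ℝ} {x : ι → ℝ}

theorem partialDeriv_congr (h : f₁ =ᶠ[𝓝 x] f₂) : partialDeriv a f₁ x = partialDeriv a f₂ x := by
  rw [partialDeriv, partialDeriv, h.fderiv_eq]

@[simp] theorem partialDeriv_const (k : ℝ) : partialDeriv a (fun _ => k) x = 0 := by
  simp [partialDeriv]

namespace HasPartialDerivAt

theorem congr (h : HasPartialDerivAt f₁ a d x) (he : f₂ =ᶠ[𝓝 x] f₁) :
    HasPartialDerivAt f₂ a d x :=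
  ⟨h.1.congr_of_eventuallyEq he, (partialDeriv_congr he).trans h.2⟩

theorem congr_val (h : HasPartialDerivAt f a d₁ x) (he : d₁ = d₂) : HasPartialDerivAt f a d₂ x :=
  he ▸ h

theorem const (k : ℝ) : HasPartialDerivAt (fun _ => k) a 0 x :=
  ⟨differentiableAt_const k, partialDeriv_const k⟩

theorem add (h₁ : HasPartialDerivAt f₁ a d₁ x) (h₂ : HasPartialDerivAt f₂ a d₂ x) :
    HasPartialDerivAt (fun y => f₁ y + f₂ y) a (d₁ + d₂) x :=
  ⟨h₁.1.fun_add h₂.1, by rw [← h₁.2, ← h₂.2]; simp [partialDeriv, fderiv_fun_add h₁.1 h₂.1]⟩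

theorem neg (h : HasPartialDerivAt f a d x) : HasPartialDerivAt (fun y => -f y) a (-d) x :=
  ⟨h.1.fun_neg, by rw [← h.2]; simp [partialDeriv]⟩

theorem sub (h₁ : HasPartialDerivAt f₁ a d₁ x) (h₂ : HasPartialDerivAt f₂ a d₂ x) :
    HasPartialDerivAt (fun y => f₁ y - f₂ y) a (d₁ - d₂) x :=
  ⟨h₁.1.fun_sub h₂.1, by rw [← h₁.2, ← h₂.2]; simp [partialDeriv, fderiv_fun_sub h₁.1 h₂.1]⟩

theorem mul (h₁ : HasPartialDerivAt f₁ a d₁ x) (h₂ : HasPartialDerivAt f₂ a d₂ x) :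
    HasPartialDerivAt (fun y => f₁ y * f₂ y) a (d₁ * f₂ x + f₁ x * d₂) x :=
  ⟨h₁.1.fun_mul h₂.1, by
    rw [← h₁.2, ← h₂.2]; simp [partialDeriv, fderiv_fun_mul h₁.1 h₂.1]; ring⟩

theorem inv (h : HasPartialDerivAt f a d x) (h0 : f x ≠ 0) :
    HasPartialDerivAt (fun y => (f y)⁻¹) a (-d / f x ^ 2) x := by
  have h' := (hasDerivAt_inv h0).comp_hasFDerivAt x h.1.hasFDerivAt
  refine ⟨h'.differentiableAt, ?_⟩
  rw [← h.2, partialDeriv]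
  change fderiv ℝ (Inv.inv ∘ f) x _ = _
  rw [h'.fderiv]
  simp [partialDeriv]
  field_simp

theorem div (h₁ : HasPartialDerivAt f₁ a d₁ x) (h₂ : HasPartialDerivAt f₂ a d₂ x)
    (h0 : f₂ x ≠ 0) :
    HasPartialDerivAt (fun y => f₁ y / f₂ y) a ((d₁ * f₂ x - f₁ x * d₂) / f₂ x ^ 2) x := by
  simp only [div_eq_mul_inv]
  refine (h₁.mul (h₂.inv h0)).congr_val ?_
  field_simp
  ring

theorem sum {κ : Type*} {S : Finset κ} {F : κ → (ι → ℝ) → ℝ} {D : κ → ℝ}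
    (h : ∀ k ∈ S, HasPartialDerivAt (F k) a (D k) x) :
    HasPartialDerivAt (fun y => ∑ k ∈ S, F k y) a (∑ k ∈ S, D k) x := by
  refine ⟨DifferentiableAt.fun_sum fun k hk => (h k hk).1, ?_⟩
  rw [partialDeriv, fderiv_fun_sum fun k hk => (h k hk).1, sum_apply]
  exact Finset.sum_congr rfl fun k hk => (h k hk).2

/-- Chain rule for a function of one coordinate. -/
theorem comp_coord {φ : ℝ → ℝ} {b : ι} (h : DifferentiableAt ℝ φ (x b)) :
    HasPartialDerivAt (fun y => φ (y b)) a (if b = a then deriv φ (x b) else 0) x := by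
  have h1 : HasFDerivAt (fun y : ι → ℝ => y b)
      (ContinuousLinearMap.proj b : (ι → ℝ) →L[ℝ] ℝ) x := hasFDerivAt_apply b x
  have h2 := h.hasDerivAt.comp_hasFDerivAt x h1
  refine ⟨h2.differentiableAt, ?_⟩
  rw [partialDeriv]
  change fderiv ℝ (φ ∘ fun y => y b) x _ = _
  rw [h2.fderiv]
  simp [Pi.single_apply]

theorem coord (b : ι) : HasPartialDerivAt (fun y => y b) a (if b = a then 1 else 0) x := by
  simpa using comp_coord (a := a) (x := x) (b := b) (φ := fun t => t) differentiableAt_id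

/-- Chain rule for a function of two coordinates. -/
theorem comp_coord₂ {φ : ℝ → ℝ → ℝ} {b c : ι}
    (h : DifferentiableAt ℝ (fun p : ℝ × ℝ => φ p.1 p.2) (x b, x c)) :
    HasPartialDerivAt (fun y => φ (y b) (y c)) a
      ((if b = a then deriv (fun t => φ t (x c)) (x b) else 0)
        + if c = a then deriv (φ (x b)) (x c) else 0) x := by
  have hL := h.hasFDerivAt
  set L := fderiv ℝ (fun p : ℝ × ℝ => φ p.1 p.2) (x b, x c)
  have h1 : HasFDerivAt (fun y : ι → ℝ => (y b, y c))
      ((ContinuousLinearMap.proj b : (ι → ℝ) →L[ℝ] ℝ).prod (ContinuousLinearMap.proj c)) x :=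
    (hasFDerivAt_apply b x).prodMk (hasFDerivAt_apply c x)
  have h2 := HasFDerivAt.comp x hL h1
  have d1 : deriv (fun t => φ t (x c)) (x b) = L (1, 0) := by
    have := hL.comp_hasDerivAt (x b) ((hasDerivAt_id (x b)).prodMk (hasDerivAt_const (x b) (x c)))
    exact this.deriv
  have d2 : deriv (φ (x b)) (x c) = L (0, 1) := by
    have := hL.comp_hasDerivAt (x c) ((hasDerivAt_const (x c) (x b)).prodMk (hasDerivAt_id (x c)))
    exact this.deriv
  refine ⟨h2.differentiableAt, ?_⟩
  rw [partialDeriv]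
  change fderiv ℝ ((fun p : ℝ × ℝ => φ p.1 p.2) ∘ fun y => (y b, y c)) x _ = _
  rw [h2.fderiv, d1, d2]
  simp only [ContinuousLinearMap.comp_apply, ContinuousLinearMap.prod_apply,
    ContinuousLinearMap.proj_apply, Pi.single_apply]
  split_ifs <;> simp [← map_add, Prod.mk_zero_zero]

end HasPartialDerivAt

end PartialDerivatives

/-- The derivative of a smooth function is smooth. -/
theorem contDiffAt_deriv {φ : ℝ → ℝ} {t : ℝ} (h : ContDiffAt ℝ ∞ φ t) :
    ContDiffAt ℝ ∞ (deriv φ) t := by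
  have : deriv φ = fun y => fderiv ℝ φ y 1 := by
    ext y
    rw [fderiv_apply_one_eq_deriv]
  rw [this]
  exact (h.fderiv_right (m := ∞) (by simp)).clm_apply contDiffAt_const

/-- The derivative in the first variable of a smooth function of two variables is smooth. -/
theorem contDiffAt_deriv_fst {φ : ℝ → ℝ → ℝ} {p : ℝ × ℝ}
    (h : ContDiffAt ℝ ∞ (fun q : ℝ × ℝ => φ q.1 q.2) p) :
    ContDiffAt ℝ ∞ (fun q : ℝ × ℝ => deriv (fun t => φ t q.2) q.1) p := by
  have h1 : ContDiffAt ℝ ∞ (fun q => fderiv ℝ (fun q : ℝ × ℝ => φ q.1 q.2) q (1, 0)) p :=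
    (h.fderiv_right (m := ∞) (by simp)).clm_apply contDiffAt_const
  refine h1.congr_of_eventuallyEq ?_
  have h2 : ∀ᶠ q in 𝓝 p, ContDiffAt ℝ 1 (fun q : ℝ × ℝ => φ q.1 q.2) q :=
    (h.of_le (m := 1) (by exact_mod_cast le_top)).eventually (by simp)
  filter_upwards [h2] with q hq
  have hL := (hq.differentiableAt (by simp)).hasFDerivAt
  have := HasFDerivAt.comp_hasDerivAt (x := q.1) (f := fun t => (t, q.2)) hL
    ((hasDerivAt_id q.1).prodMk (hasDerivAt_const q.1 q.2))
  exact this.deriv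

/-- The derivative in the second variable of a smooth function of two variables is smooth. -/
theorem contDiffAt_deriv_snd {φ : ℝ → ℝ → ℝ} {p : ℝ × ℝ}
    (h : ContDiffAt ℝ ∞ (fun q : ℝ × ℝ => φ q.1 q.2) p) :
    ContDiffAt ℝ ∞ (fun q : ℝ × ℝ => deriv (φ q.1) q.2) p := by
  have h1 : ContDiffAt ℝ ∞ (fun q : ℝ × ℝ => φ q.2 q.1) p.swap :=
    ContDiffAt.comp (p.swap) (f := Prod.swap) h (contDiffAt_snd.prodMk contDiffAt_fst)
  exact ContDiffAt.comp p (f := Prod.swap)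
    (contDiffAt_deriv_fst (φ := fun a b => φ b a) h1) (contDiffAt_snd.prodMk contDiffAt_fst)

/-! ### Smoothness and derivatives of `β` and `u` -/

variable {n : ℕ}

/-- The sum `∑_{a ≠ k} ε^{ak}_{,η^k} β_{ai}`. -/
def dEpsBeta (ε : Fin n → Fin n → ℝ → ℝ → ℝ) (k i : Fin n) (x : Point n) : ℝ :=
  ∑ a with a ≠ k, epsD₂ ε a k x * beta ε x a i

/-- The sum `∑_{a ≠ k} u^a ε^{ak}_{,η^k}`. -/
def dEpsU (ε : Fin n → Fin n → ℝ → ℝ → ℝ) (k : Fin n) (x : Point n) : ℝ :=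
  ∑ a with a ≠ k, u ε a x * epsD₂ ε a k x

/-- The regularity assumptions on the functions that define the metric. -/
structure IsSmoothData (ε : Fin n → Fin n → ℝ → ℝ → ℝ) (s : Fin n → ℝ → ℝ)
    (g : Fin n → ℝ → ℝ → ℝ) (U : Set (Point n)) : Prop where
  isOpen : IsOpen U
  symm : ∀ x ∈ U, ∀ i j, i ≠ j → eps ε i j x = eps ε j i x
  eps_smooth : ∀ x ∈ U, ∀ i j, i ≠ j →
    ContDiffAt ℝ ∞ (fun p : ℝ × ℝ => ε i j p.1 p.2) (x.eta i, x.eta j)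
  s_smooth : ∀ x ∈ U, ∀ i, ContDiffAt ℝ ∞ (s i) (x.eta i)
  s_ne_zero : ∀ x ∈ U, ∀ i, s i (x.eta i) ≠ 0
  g_smooth : ∀ x ∈ U, ∀ i, ContDiffAt ℝ ∞ (fun p : ℝ × ℝ => g i p.1 p.2) (x.r i, x.eta i)

/-! ### Smoothness of determinants and inverse matrices. -/

theorem contDiffAt_matrix_det {E ι : Type*} [NormedAddCommGroup E] [NormedSpace ℝ E] [Fintype ι]
    [DecidableEq ι] {A : E → Matrix ι ι ℝ} {x : E}
    (h : ∀ i j, ContDiffAt ℝ ∞ (fun y => A y i j) x) : ContDiffAt ℝ ∞ (fun y => (A y).det) x := by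
  simp only [Matrix.det_apply']
  exact ContDiffAt.sum fun σ _ => contDiffAt_const.mul (contDiffAt_prod fun i _ => h _ _)

theorem contDiffAt_matrix_inv {E ι : Type*} [NormedAddCommGroup E] [NormedSpace ℝ E] [Fintype ι]
    [DecidableEq ι] {A : E → Matrix ι ι ℝ} {x : E}
    (h : ∀ i j, ContDiffAt ℝ ∞ (fun y => A y i j) x) (h0 : (A x).det ≠ 0) (i j : ι) :
    ContDiffAt ℝ ∞ (fun y => (A y)⁻¹ i j) x := by
  simp only [Matrix.inv_def, Ring.inverse_eq_inv', Matrix.smul_apply, smul_eq_mul,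
    Matrix.adjugate_apply]
  refine ((contDiffAt_matrix_det h).inv h0).mul (contDiffAt_matrix_det fun k l => ?_)
  simp only [Matrix.updateRow_apply]
  split_ifs
  · exact contDiffAt_const
  · exact h k l

namespace IsSmoothData

variable {ε : Fin n → Fin n → ℝ → ℝ → ℝ} {s : Fin n → ℝ → ℝ} {g : Fin n → ℝ → ℝ → ℝ}
  {U : Set (Point n)} {x : Point n}

theorem contDiffAt_pair (p q : Fin 2 × Fin n) :
    ContDiffAt ℝ ∞ (fun y : Point n => (y p, y q)) x :=
  (contDiff_apply ℝ ℝ p).contDiffAt.prodMk (contDiff_apply ℝ ℝ q).contDiffAt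

theorem contDiffAt_eps (h : IsSmoothData ε s g U) (hx : x ∈ U) {i j : Fin n} (hij : i ≠ j) :
    ContDiffAt ℝ ∞ (eps ε i j) x :=
  ContDiffAt.comp x (f := fun y : Point n => (y.eta i, y.eta j)) (h.eps_smooth x hx i j hij)
    (contDiffAt_pair _ _)

theorem contDiffAt_epsHat (h : IsSmoothData ε s g U) (hx : x ∈ U) (i j : Fin n) :
    ContDiffAt ℝ ∞ (fun y => epsHat ε y i j) x := by
  by_cases hij : i = j
  · simp only [epsHat, Matrix.of_apply, hij, if_true]
    exact (contDiff_apply ℝ ℝ _).contDiffAt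
  · simp only [epsHat, Matrix.of_apply, hij, if_false]
    exact h.contDiffAt_eps hx hij

theorem contDiffAt_beta (h : IsSmoothData ε s g U) (hx : x ∈ U ∩ regularLocus ε) (i j : Fin n) :
    ContDiffAt ℝ ∞ (fun y => beta ε y i j) x := by
  simp only [beta, Matrix.neg_apply]
  exact (contDiffAt_matrix_inv (h.contDiffAt_epsHat hx.1) hx.2.1 i j).neg

theorem contDiffAt_u (h : IsSmoothData ε s g U) (hx : x ∈ U ∩ regularLocus ε) (i : Fin n) :
    ContDiffAt ℝ ∞ (u ε i) x :=
  ContDiffAt.sum fun k _ => h.contDiffAt_beta hx k i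

/-- Nonvanishing of the determinant and of the u^i is an open condition. This is what allows
formulas valid on the regular locus to be differentiated there. -/
theorem regular_mem_nhds (h : IsSmoothData ε s g U) (hx : x ∈ U ∩ regularLocus ε) :
    U ∩ regularLocus ε ∈ 𝓝 x := by
  have h1 := (contDiffAt_matrix_det (h.contDiffAt_epsHat hx.1)).continuousAt.eventually_ne hx.2.1
  have h2 : ∀ᶠ y in 𝓝 x, ∀ i, u ε i y ≠ 0 :=
    Filter.eventually_all.2 fun i => (h.contDiffAt_u hx i).continuousAt.eventually_ne (hx.2.2 i)
  filter_upwards [h.isOpen.mem_nhds hx.1, h1, h2] with y hy h1 h2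
  exact ⟨hy, h1, h2⟩

theorem epsHat_symm (h : IsSmoothData ε s g U) (hx : x ∈ U) :
    (epsHat ε x).transpose = epsHat ε x := by
  ext i j
  simp only [epsHat, Matrix.transpose_apply, Matrix.of_apply]
  by_cases hij : i = j
  · simp [hij]
  · simp [hij, Ne.symm hij, h.symm x hx i j hij]

theorem beta_symm (h : IsSmoothData ε s g U) (hx : x ∈ U) (i j : Fin n) :
    beta ε x i j = beta ε x j i := by
  have h1 : (beta ε x).transpose = beta ε x := by
    rw [beta, Matrix.transpose_neg, Matrix.transpose_nonsing_inv, h.epsHat_symm hx]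
  exact (congrFun (congrFun h1 j) i)

/-- Symmetry of ε is known only at points of U, but U is open, so it persists when η^i alone moves
slightly, and the two one-variable functions have the same germ. -/
theorem epsD₁_eq_epsD₂ (h : IsSmoothData ε s g U) (hx : x ∈ U) {i j : Fin n} (hij : i ≠ j) :
    epsD₁ ε i j x = epsD₂ ε j i x := by
  have hc : ContinuousAt (fun t => Function.update x (1, i) t) (x.eta i) :=
    (continuous_const.update (1, i) continuous_id).continuousAt
  have h1 : ∀ᶠ t in 𝓝 (x.eta i), Function.update x (1, i) t ∈ U :=
    hc.eventually (h.isOpen.mem_nhds (by simpa using hx))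
  refine Filter.EventuallyEq.deriv_eq ?_
  filter_upwards [h1] with t ht
  have := h.symm _ ht i j hij
  simpa [eps, Point.eta, hij, Ne.symm hij] using this

/-! ### First derivatives of the matrix e, of β and of u. -/

theorem hasPartialDerivAt_eps (h : IsSmoothData ε s g U) (hx : x ∈ U) {i j : Fin n} (hij : i ≠ j)
    (a : Fin 2 × Fin n) :
    HasPartialDerivAt (eps ε i j) a
      ((if (1, i) = a then epsD₂ ε j i x else 0) + if (1, j) = a then epsD₂ ε i j x else 0) x := by
  rw [← h.epsD₁_eq_epsD₂ hx hij]
  exact HasPartialDerivAt.comp_coord₂ (φ := ε i j)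
    ((h.eps_smooth x hx i j hij).differentiableAt (by simp))

/-- The partial derivatives of `epsHat`. -/
def dEpsHat (ε : Fin n → Fin n → ℝ → ℝ → ℝ) (a : Fin 2 × Fin n) (x : Point n) :
    Matrix (Fin n) (Fin n) ℝ :=
  Matrix.of fun i j => if i = j then (if (0, i) = a then 1 else 0) else
    ((if (1, i) = a then epsD₂ ε j i x else 0) + if (1, j) = a then epsD₂ ε i j x else 0)

theorem hasPartialDerivAt_epsHat (h : IsSmoothData ε s g U) (hx : x ∈ U) (i j : Fin n)
    (a : Fin 2 × Fin n) :
    HasPartialDerivAt (fun y => epsHat ε y i j) a (dEpsHat ε a x i j) x := by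
  by_cases hij : i = j
  · simp only [epsHat, dEpsHat, Matrix.of_apply, hij, if_true]
    exact HasPartialDerivAt.coord _
  · simp only [epsHat, dEpsHat, Matrix.of_apply, hij, if_false]
    exact h.hasPartialDerivAt_eps hx hij a

theorem epsHat_mul_beta (hx : x ∈ regularLocus ε) : epsHat ε x * beta ε x = -1 := by
  rw [beta, mul_neg, Matrix.mul_nonsing_inv _ (isUnit_iff_ne_zero.2 hx.1)]

theorem beta_mul_epsHat (hx : x ∈ regularLocus ε) : beta ε x * epsHat ε x = -1 := by
  rw [beta, neg_mul, Matrix.nonsing_inv_mul _ (isUnit_iff_ne_zero.2 hx.1)]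

/-- Differentiating eβ = -1 gives (∂e)β + e ∂β = 0; multiplying by β on the left and using βe = -1
gives ∂β = β(∂e)β. -/
theorem hasPartialDerivAt_beta (h : IsSmoothData ε s g U) (hx : x ∈ U ∩ regularLocus ε)
    (i j : Fin n) (a : Fin 2 × Fin n) :
    HasPartialDerivAt (fun y => beta ε y i j) a
      ((beta ε x * dEpsHat ε a x * beta ε x) i j) x := by
  set D : Matrix (Fin n) (Fin n) ℝ := Matrix.of fun i j => partialDeriv a (fun y => beta ε y i j) x
  have hD : ∀ i j, HasPartialDerivAt (fun y => beta ε y i j) a (D i j) x := fun i j =>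
    ⟨(h.contDiffAt_beta hx i j).differentiableAt (by simp), rfl⟩
  have h1 : dEpsHat ε a x * beta ε x + epsHat ε x * D = 0 := by
    ext i j
    have h2 : HasPartialDerivAt (fun y => (epsHat ε y * beta ε y) i j) a
        (∑ l, (dEpsHat ε a x i l * beta ε x l j + epsHat ε x i l * D l j)) x := by
      simp only [Matrix.mul_apply]
      exact HasPartialDerivAt.sum fun l _ => (h.hasPartialDerivAt_epsHat hx.1 i l a).mul (hD l j)
    have h3 : HasPartialDerivAt (fun y => (epsHat ε y * beta ε y) i j) a 0 x := by
      refine (HasPartialDerivAt.const ((-1 : Matrix (Fin n) (Fin n) ℝ) i j)).congr ?_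
      filter_upwards [h.regular_mem_nhds hx] with y hy
      rw [epsHat_mul_beta hy.2]
    have := h2.2.symm.trans h3.2
    simpa [Matrix.mul_apply, Finset.sum_add_distrib] using this
  have h2 : D = beta ε x * dEpsHat ε a x * beta ε x := by
    have := congrArg (beta ε x * ·) h1
    simp only [mul_add, ← mul_assoc, beta_mul_epsHat hx.2, mul_zero] at this
    rw [neg_one_mul, add_neg_eq_zero] at this
    exact this.symm
  rw [← h2]
  exact hD i j

theorem hasPartialDerivAt_beta_r (h : IsSmoothData ε s g U) (hx : x ∈ U ∩ regularLocus ε)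
    (i j k : Fin n) :
    HasPartialDerivAt (fun y => beta ε y i j) (0, k) (beta ε x i k * beta ε x k j) x := by
  refine (h.hasPartialDerivAt_beta hx i j (0, k)).congr_val ?_
  -- The variable r^k enters e only at the diagonal position (k, k), so ∂e is a matrix unit and ∂β
  -- has rank at most one.
  have : dEpsHat ε (0, k) x = Matrix.single k k 1 := by
    ext a b
    simp only [dEpsHat, Matrix.of_apply, Matrix.single_apply]
    by_cases hab : a = b <;> by_cases hak : a = k <;> simp_all [eq_comm]
  rw [this, Matrix.mul_apply]
  simp [Matrix.mul_apply, Matrix.single_apply, ite_and]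

theorem hasPartialDerivAt_beta_eta (h : IsSmoothData ε s g U) (hx : x ∈ U ∩ regularLocus ε)
    (i j k : Fin n) :
    HasPartialDerivAt (fun y => beta ε y i j) (1, k)
      (dEpsBeta ε k i x * beta ε x k j + beta ε x i k * dEpsBeta ε k j x) x := by
  refine (h.hasPartialDerivAt_beta hx i j (1, k)).congr_val ?_
  -- The variable η^k enters only row k and column k of e, off the diagonal; these two pieces give
  -- the two summands.
  have hd : ∀ a b, dEpsHat ε (1, k) x a b =
      (if b = k then (if a ≠ k then epsD₂ ε a k x else 0) else 0)
        + (if a = k then (if b ≠ k then epsD₂ ε b k x else 0) else 0) := by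
    intro a b
    simp only [dEpsHat, Matrix.of_apply]
    by_cases hab : a = b <;> by_cases hak : a = k <;> by_cases hbk : b = k <;> simp_all
  simp only [Matrix.mul_apply, hd, mul_add, Finset.sum_add_distrib, add_mul]
  simp only [mul_ite, mul_zero, Finset.sum_ite_irrel, Finset.sum_const_zero, ite_mul, zero_mul,
    Finset.sum_ite_eq', Finset.mem_univ, if_true, dEpsBeta, Finset.sum_filter,
    Finset.sum_mul, Finset.mul_sum]
  congr 1
  · refine Finset.sum_congr rfl fun a _ => ?_
    rw [h.beta_symm hx.1 i a]
    split_ifs <;> ring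
  · refine Finset.sum_congr rfl fun a _ => ?_
    split_ifs <;> ring

theorem sum_beta_row (h : IsSmoothData ε s g U) (hx : x ∈ U) (i : Fin n) :
    ∑ k, beta ε x i k = u ε i x :=
  Finset.sum_congr rfl fun k _ => h.beta_symm hx i k

theorem hasPartialDerivAt_u_r (h : IsSmoothData ε s g U) (hx : x ∈ U ∩ regularLocus ε)
    (i k : Fin n) : HasPartialDerivAt (u ε i) (0, k) (u ε k x * beta ε x k i) x := by
  refine (HasPartialDerivAt.sum fun l _ => h.hasPartialDerivAt_beta_r hx l i k).congr_val ?_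
  rw [← Finset.sum_mul, u]

theorem sum_dEpsBeta (h : IsSmoothData ε s g U) (hx : x ∈ U) (k : Fin n) :
    ∑ l, dEpsBeta ε k l x = dEpsU ε k x := by
  simp only [dEpsBeta, dEpsU]
  rw [Finset.sum_comm]
  refine Finset.sum_congr rfl fun a _ => ?_
  rw [← Finset.mul_sum, h.sum_beta_row hx, mul_comm]

theorem hasPartialDerivAt_u_eta (h : IsSmoothData ε s g U) (hx : x ∈ U ∩ regularLocus ε)
    (i k : Fin n) : HasPartialDerivAt (u ε i) (1, k)
      (u ε k x * dEpsBeta ε k i x + beta ε x k i * dEpsU ε k x) x := by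
  refine (HasPartialDerivAt.sum fun l _ => h.hasPartialDerivAt_beta_eta hx l i k).congr_val ?_
  rw [Finset.sum_add_distrib, ← Finset.sum_mul, ← Finset.sum_mul, h.sum_dEpsBeta hx.1, u]
  ring

theorem hasPartialDerivAt_epsD₂_r (h : IsSmoothData ε s g U) (hx : x ∈ U) {i j : Fin n}
    (hij : i ≠ j) (k : Fin n) : HasPartialDerivAt (epsD₂ ε i j) (0, k) 0 x := by
  refine (HasPartialDerivAt.comp_coord₂ (φ := fun p q => deriv (ε i j p) q) (x := x) (b := (1, i))
    (c := (1, j)) ((contDiffAt_deriv_snd (h.eps_smooth x hx i j hij)).differentiableAt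
      (by simp))).congr_val ?_
  simp

/-- The derivatives of ε do not depend on r, so only β is differentiated. Differentiation in r thus
stays within products of β, u and these sums. -/
theorem hasPartialDerivAt_dEpsBeta_r (h : IsSmoothData ε s g U) (hx : x ∈ U ∩ regularLocus ε)
    (i j k : Fin n) :
    HasPartialDerivAt (dEpsBeta ε i j) (0, k) (dEpsBeta ε i k x * beta ε x k j) x := by
  refine (HasPartialDerivAt.sum fun a ha => (h.hasPartialDerivAt_epsD₂_r hx.1
    (Finset.mem_filter.1 ha).2 k).mul (h.hasPartialDerivAt_beta_r hx a j k)).congr_val ?_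
  rw [dEpsBeta, Finset.sum_mul]
  exact Finset.sum_congr rfl fun a _ => by ring

theorem hasPartialDerivAt_dEpsU_r (h : IsSmoothData ε s g U) (hx : x ∈ U ∩ regularLocus ε)
    (i k : Fin n) :
    HasPartialDerivAt (dEpsU ε i) (0, k) (u ε k x * dEpsBeta ε i k x) x := by
  refine (HasPartialDerivAt.sum fun a ha => (h.hasPartialDerivAt_u_r hx a k).mul
    (h.hasPartialDerivAt_epsD₂_r hx.1 (Finset.mem_filter.1 ha).2 k)).congr_val ?_
  rw [dEpsBeta, Finset.mul_sum]
  refine Finset.sum_congr rfl fun a _ => ?_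
  rw [h.beta_symm hx.1 k a]
  ring

theorem hasPartialDerivAt_s (h : IsSmoothData ε s g U) (hx : x ∈ U) (i : Fin n)
    (a : Fin 2 × Fin n) :
    HasPartialDerivAt (fun y => s i (y (1, i))) a
      (if (1, i) = a then deriv (s i) (x (1, i)) else 0) x :=
  HasPartialDerivAt.comp_coord ((h.s_smooth x hx i).differentiableAt (by simp))

theorem hasPartialDerivAt_g_r (h : IsSmoothData ε s g U) (hx : x ∈ U) (i k : Fin n) :
    HasPartialDerivAt (fun y => g i (y (0, i)) (y (1, i))) (0, k)
      (if i = k then deriv (fun t => g i t (x (1, i))) (x (0, i)) else 0) x := by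
  refine (HasPartialDerivAt.comp_coord₂ (φ := g i)
    ((h.g_smooth x hx i).differentiableAt (by simp))).congr_val ?_
  simp

theorem hasPartialDerivAt_deriv_g_r (h : IsSmoothData ε s g U) (hx : x ∈ U) (i k : Fin n) :
    HasPartialDerivAt (fun y => deriv (fun t => g i t (y (1, i))) (y (0, i))) (0, k)
      (if i = k then deriv (deriv fun t => g i t (x (1, i))) (x (0, i)) else 0) x := by
  refine (HasPartialDerivAt.comp_coord₂ (φ := fun p q => deriv (fun t => g i t q) p)
    ((contDiffAt_deriv_fst (h.g_smooth x hx i)).differentiableAt (by simp))).congr_val ?_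
  simp

end IsSmoothData

/-! ### Christoffel symbols of block diagonal metrics -/

/-- The block diagonal matrix with the blocks `(0, A_i; A_i, B_i)`. -/
def hankelBlocks (A B : Fin n → Point n → ℝ) (x : Point n) :
    Matrix (Fin 2 × Fin n) (Fin 2 × Fin n) ℝ :=
  Matrix.blockDiagonal fun i => !![0, A i x; A i x, B i x]

section Blocks

variable {G : Point n → Matrix (Fin 2 × Fin n) (Fin 2 × Fin n) ℝ} {A B : Fin n → Point n → ℝ}
  {x : Point n} {ν μ : Fin n → ℝ}

theorem partialDeriv_entry_rr (hG : G =ᶠ[𝓝 x] hankelBlocks A B) (a : Fin 2 × Fin n) (i j : Fin n) :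
    partialDeriv a (fun y => G y (0, i) (0, j)) x = 0 := by
  rw [partialDeriv_congr (f₂ := fun _ => 0), partialDeriv_const]
  filter_upwards [hG] with y hy
  simp [hy, hankelBlocks, Matrix.blockDiagonal_apply]

theorem partialDeriv_entry_reta (hG : G =ᶠ[𝓝 x] hankelBlocks A B) (a : Fin 2 × Fin n)
    (i j : Fin n) : partialDeriv a (fun y => G y (0, i) (1, j)) x =
      if i = j then partialDeriv a (A i) x else 0 := by
  rw [partialDeriv_congr (f₂ := fun y => if i = j then A i y else 0)]
  · split_ifs <;> simp
  filter_upwards [hG] with y hy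
  simp [hy, hankelBlocks, Matrix.blockDiagonal_apply]

theorem partialDeriv_entry_etar (hG : G =ᶠ[𝓝 x] hankelBlocks A B) (a : Fin 2 × Fin n)
    (i j : Fin n) : partialDeriv a (fun y => G y (1, i) (0, j)) x =
      if i = j then partialDeriv a (A i) x else 0 := by
  rw [partialDeriv_congr (f₂ := fun y => if i = j then A i y else 0)]
  · split_ifs <;> simp
  filter_upwards [hG] with y hy
  simp [hy, hankelBlocks, Matrix.blockDiagonal_apply]

theorem partialDeriv_entry_etaeta (hG : G =ᶠ[𝓝 x] hankelBlocks A B) (a : Fin 2 × Fin n)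
    (i j : Fin n) : partialDeriv a (fun y => G y (1, i) (1, j)) x =
      if i = j then partialDeriv a (B i) x else 0 := by
  rw [partialDeriv_congr (f₂ := fun y => if i = j then B i y else 0)]
  · split_ifs <;> simp
  filter_upwards [hG] with y hy
  simp [hy, hankelBlocks, Matrix.blockDiagonal_apply]

/-- The row of the inverse metric belonging to η^i has ν_i, in column r^i, as its only possibly
nonzero entry, so a single term of the sum survives. -/
theorem christoffel_eta
    (hI : (G x)⁻¹ = Matrix.blockDiagonal fun i => !![μ i, ν i; ν i, 0])
    (i : Fin n) (p q : Fin 2 × Fin n) :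
    christoffel G (1, i) p q x = (1 / 2) * (ν i *
      (partialDeriv q (fun y => G y (0, i) p) x + partialDeriv p (fun y => G y (0, i) q) x
        - partialDeriv (0, i) (fun y => G y p q) x)) := by
  rw [christoffel, hI]
  simp [Fintype.sum_prod_type, Matrix.blockDiagonal_apply, ite_mul]

theorem christoffel_r
    (hI : (G x)⁻¹ = Matrix.blockDiagonal fun i => !![μ i, ν i; ν i, 0])
    (i : Fin n) (p q : Fin 2 × Fin n) :
    christoffel G (0, i) p q x = (1 / 2) * (μ i *
      (partialDeriv q (fun y => G y (0, i) p) x + partialDeriv p (fun y => G y (0, i) q) x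
        - partialDeriv (0, i) (fun y => G y p q) x) + ν i *
      (partialDeriv q (fun y => G y (1, i) p) x + partialDeriv p (fun y => G y (1, i) q) x
        - partialDeriv (1, i) (fun y => G y p q) x)) := by
  rw [christoffel, hI]
  simp [Fintype.sum_prod_type, Matrix.blockDiagonal_apply, ite_mul]

theorem christoffel_eta_eta_eta_self (hG : G =ᶠ[𝓝 x] hankelBlocks A B)
    (hI : (G x)⁻¹ = Matrix.blockDiagonal fun i => !![μ i, ν i; ν i, 0])
    (i : Fin n) : christoffel G (1, i) (1, i) (1, i) x =
    ν i * (partialDeriv (1, i) (A i) x - partialDeriv (0, i) (B i) x / 2) := by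
  rw [christoffel_eta hI]
  simp only [partialDeriv_entry_reta hG, partialDeriv_entry_etaeta hG, if_true]
  ring

theorem christoffel_eta_eta_r_self (hG : G =ᶠ[𝓝 x] hankelBlocks A B)
    (hI : (G x)⁻¹ = Matrix.blockDiagonal fun i => !![μ i, ν i; ν i, 0])
    (i : Fin n) : christoffel G (1, i) (1, i) (0, i) x = 0 := by
  rw [christoffel_eta hI]
  simp [partialDeriv_entry_reta hG, partialDeriv_entry_etar hG, partialDeriv_entry_rr hG]

theorem christoffel_eta_eta_same (hG : G =ᶠ[𝓝 x] hankelBlocks A B)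
    (hI : (G x)⁻¹ = Matrix.blockDiagonal fun i => !![μ i, ν i; ν i, 0])
    {i k : Fin n} (h : k ≠ i) (b : Fin 2) :
    christoffel G (1, i) (1, i) (b, k) x = ν i * partialDeriv (b, k) (A i) x / 2 := by
  rw [christoffel_eta hI]
  fin_cases b <;> simp [partialDeriv_entry_reta hG, partialDeriv_entry_etar hG,
    partialDeriv_entry_rr hG, partialDeriv_entry_etaeta hG, Ne.symm h] <;> ring

theorem christoffel_eta_same_eta (hG : G =ᶠ[𝓝 x] hankelBlocks A B)
    (hI : (G x)⁻¹ = Matrix.blockDiagonal fun i => !![μ i, ν i; ν i, 0])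
    {i k : Fin n} (h : k ≠ i) (b : Fin 2) :
    christoffel G (1, i) (b, k) (1, i) x = ν i * partialDeriv (b, k) (A i) x / 2 := by
  rw [christoffel_eta hI]
  fin_cases b <;> simp [partialDeriv_entry_reta hG, partialDeriv_entry_rr hG,
    partialDeriv_entry_etaeta hG, h, Ne.symm h] <;> ring

theorem christoffel_eta_eta_r (hG : G =ᶠ[𝓝 x] hankelBlocks A B)
    (hI : (G x)⁻¹ = Matrix.blockDiagonal fun i => !![μ i, ν i; ν i, 0])
    {i j : Fin n} (h : j ≠ i) :
    christoffel G (1, i) (1, j) (0, j) x = -(ν i * partialDeriv (0, i) (A j) x / 2) := by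
  rw [christoffel_eta hI]
  simp [partialDeriv_entry_reta hG, partialDeriv_entry_etar hG, partialDeriv_entry_rr hG,
    Ne.symm h]
  ring

theorem christoffel_eta_r_eta (hG : G =ᶠ[𝓝 x] hankelBlocks A B)
    (hI : (G x)⁻¹ = Matrix.blockDiagonal fun i => !![μ i, ν i; ν i, 0])
    {i j : Fin n} (h : j ≠ i) :
    christoffel G (1, i) (0, j) (1, j) x = -(ν i * partialDeriv (0, i) (A j) x / 2) := by
  rw [christoffel_eta hI]
  simp [partialDeriv_entry_reta hG, partialDeriv_entry_rr hG, Ne.symm h]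
  ring

/-- The r-directions are null and mutually orthogonal, and an upper index η^i comes only from the
lowered index r^i, so only derivatives of vanishing entries occur. -/
theorem christoffel_eta_r_r (hG : G =ᶠ[𝓝 x] hankelBlocks A B)
    (hI : (G x)⁻¹ = Matrix.blockDiagonal fun i => !![μ i, ν i; ν i, 0])
    (i j k : Fin n) : christoffel G (1, i) (0, j) (0, k) x = 0 := by
  rw [christoffel_eta hI]
  simp [partialDeriv_entry_rr hG]

theorem christoffel_eta_r_eta_of_ne (hG : G =ᶠ[𝓝 x] hankelBlocks A B)
    (hI : (G x)⁻¹ = Matrix.blockDiagonal fun i => !![μ i, ν i; ν i, 0])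
    {i j k : Fin n} (hk : k ≠ i) (hkj : k ≠ j) :
    christoffel G (1, i) (0, j) (1, k) x = 0 := by
  rw [christoffel_eta hI]
  simp [partialDeriv_entry_reta hG, partialDeriv_entry_rr hG, Ne.symm hk, Ne.symm hkj]

theorem christoffel_eta_r_eta_self (hG : G =ᶠ[𝓝 x] hankelBlocks A B)
    (hI : (G x)⁻¹ = Matrix.blockDiagonal fun i => !![μ i, ν i; ν i, 0])
    (i : Fin n) : christoffel G (1, i) (0, i) (1, i) x = 0 := by
  rw [christoffel_eta hI]
  simp [partialDeriv_entry_reta hG, partialDeriv_entry_rr hG]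

theorem christoffel_r_eta_r (hG : G =ᶠ[𝓝 x] hankelBlocks A B)
    (hI : (G x)⁻¹ = Matrix.blockDiagonal fun i => !![μ i, ν i; ν i, 0])
    {j k : Fin n} (h : j ≠ k) :
    christoffel G (0, k) (1, j) (0, j) x =
      -((μ k * partialDeriv (0, k) (A j) x + ν k * partialDeriv (1, k) (A j) x) / 2) := by
  rw [christoffel_r hI]
  simp [partialDeriv_entry_reta hG, partialDeriv_entry_etar hG, partialDeriv_entry_rr hG,
    partialDeriv_entry_etaeta hG, Ne.symm h]
  ring

theorem christoffel_r_eta_r_self (hG : G =ᶠ[𝓝 x] hankelBlocks A B)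
    (hI : (G x)⁻¹ = Matrix.blockDiagonal fun i => !![μ i, ν i; ν i, 0])
    (j : Fin n) :
    christoffel G (0, j) (1, j) (0, j) x = ν j * partialDeriv (0, j) (B j) x / 2 := by
  rw [christoffel_r hI]
  simp [partialDeriv_entry_reta hG, partialDeriv_entry_etar hG, partialDeriv_entry_rr hG,
    partialDeriv_entry_etaeta hG]
  ring

end Blocks

/-! ### The metric on the regular locus -/

/-- The covariant entry `g_{r^i η^i}`. -/
def covRE (ε : Fin n → Fin n → ℝ → ℝ → ℝ) (s : Fin n → ℝ → ℝ) (i : Fin n) (x : Point n) : ℝ :=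
  u ε i x * u ε i x / s i (x (1, i))

/-- The covariant entry `g_{η^i η^i}`. -/
def covEE (ε : Fin n → Fin n → ℝ → ℝ → ℝ) (s : Fin n → ℝ → ℝ) (g : Fin n → ℝ → ℝ → ℝ)
    (i : Fin n) (x : Point n) : ℝ :=
  2 * (u ε i x * dEpsU ε i x) / s i (x (1, i))
    - g i (x (0, i)) (x (1, i)) * (u ε i x * u ε i x) / (s i (x (1, i)) * s i (x (1, i)))

namespace IsSmoothData

variable {ε : Fin n → Fin n → ℝ → ℝ → ℝ} {s : Fin n → ℝ → ℝ} {g : Fin n → ℝ → ℝ → ℝ}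
  {U : Set (Point n)} {x : Point n}

/-- The block (m, n; n, 0) has inverse (0, 1/n; 1/n, -m/n²), and -m/n² is the entry `covEE`. -/
theorem contravariantMetric_mul (h : IsSmoothData ε s g U) (hx : x ∈ U ∩ regularLocus ε) :
    contravariantMetric ε s g x * hankelBlocks (covRE ε s) (covEE ε s g) x = 1 := by
  rw [contravariantMetric, hankelBlocks, ← Matrix.blockDiagonal_mul, ← Matrix.blockDiagonal_one]
  congr 1
  funext i
  have hu := hx.2.2 i
  have hs : s i (x (1, i)) ≠ 0 := h.s_ne_zero x hx.1 i
  have hm : mEntry ε s g i x = -(2 * s i (x (1, i)) / u ε i x ^ 3) * dEpsU ε i x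
    + g i (x (0, i)) (x (1, i)) / u ε i x ^ 2 := rfl
  have hn : nEntry ε s i x = s i (x (1, i)) / u ε i x ^ 2 := rfl
  rw [Matrix.mul_fin_two, hm, hn, Pi.one_apply, Matrix.one_fin_two]
  simp only [covRE, covEE]
  ext a b
  fin_cases a <;> fin_cases b <;> (simp; try field_simp; try ring)

theorem metric_eq (h : IsSmoothData ε s g U) (hx : x ∈ U ∩ regularLocus ε) :
    metric ε s g x = hankelBlocks (covRE ε s) (covEE ε s g) x :=
  Matrix.inv_eq_right_inv (h.contravariantMetric_mul hx)

theorem metric_eventuallyEq (h : IsSmoothData ε s g U) (hx : x ∈ U ∩ regularLocus ε) :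
    metric ε s g =ᶠ[𝓝 x] hankelBlocks (covRE ε s) (covEE ε s g) := by
  filter_upwards [h.regular_mem_nhds hx] with y hy using h.metric_eq hy

theorem metric_inv (h : IsSmoothData ε s g U) (hx : x ∈ U ∩ regularLocus ε) :
    (metric ε s g x)⁻¹ = Matrix.blockDiagonal fun i =>
      !![mEntry ε s g i x, nEntry ε s i x; nEntry ε s i x, 0] := by
  rw [h.metric_eq hx]
  exact Matrix.inv_eq_left_inv (h.contravariantMetric_mul hx)

theorem partialDeriv_covRE_r (h : IsSmoothData ε s g U) (hx : x ∈ U ∩ regularLocus ε)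
    (i k : Fin n) : partialDeriv (0, k) (covRE ε s i) x =
      2 * u ε i x * (u ε k x * beta ε x k i) / s i (x (1, i)) := by
  have hs : s i (x (1, i)) ≠ 0 := h.s_ne_zero x hx.1 i
  have hu := h.hasPartialDerivAt_u_r hx i k
  refine ((hu.mul hu).div (h.hasPartialDerivAt_s hx.1 i (0, k)) hs).2.trans ?_
  simp
  field_simp
  ring

theorem partialDeriv_covRE_eta (h : IsSmoothData ε s g U) (hx : x ∈ U ∩ regularLocus ε)
    (i k : Fin n) : partialDeriv (1, k) (covRE ε s i) x =
      2 * u ε i x * (u ε k x * dEpsBeta ε k i x + beta ε x k i * dEpsU ε k x) / s i (x (1, i))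
        - if i = k then u ε i x ^ 2 * deriv (s i) (x (1, i)) / s i (x (1, i)) ^ 2 else 0 := by
  have hs : s i (x (1, i)) ≠ 0 := h.s_ne_zero x hx.1 i
  have hu := h.hasPartialDerivAt_u_eta hx i k
  refine ((hu.mul hu).div (h.hasPartialDerivAt_s hx.1 i (1, k)) hs).2.trans ?_
  by_cases hik : i = k
  · simp only [hik, if_true]
    subst hik
    field_simp
    ring
  · simp [hik]
    field_simp
    ring

theorem partialDeriv_covEE_r (h : IsSmoothData ε s g U) (hx : x ∈ U ∩ regularLocus ε)
    (i : Fin n) : partialDeriv (0, i) (covEE ε s g i) x =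
      2 * (u ε i x * beta ε x i i * dEpsU ε i x + u ε i x * (u ε i x * dEpsBeta ε i i x))
          / s i (x (1, i))
        - (deriv (fun t => g i t (x (1, i))) (x (0, i)) + 2 * g i (x (0, i)) (x (1, i))
            * beta ε x i i) * u ε i x ^ 2 / s i (x (1, i)) ^ 2 := by
  have hs : s i (x (1, i)) ≠ 0 := h.s_ne_zero x hx.1 i
  have hu := h.hasPartialDerivAt_u_r hx i i
  have hS := h.hasPartialDerivAt_s hx.1 i (0, i)
  have h1 := ((HasPartialDerivAt.const 2).mul (hu.mul (h.hasPartialDerivAt_dEpsU_r hx i i))).div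
    hS hs
  have h2 := ((h.hasPartialDerivAt_g_r hx.1 i i).mul (hu.mul hu)).div (hS.mul hS)
    (mul_ne_zero hs hs)
  refine (h1.sub h2).2.trans ?_
  simp
  field_simp
  ring

end IsSmoothData

theorem nEntry_eq (ε : Fin n → Fin n → ℝ → ℝ → ℝ) (s : Fin n → ℝ → ℝ) (i : Fin n) (x : Point n) :
    nEntry ε s i x = s i (x (1, i)) / u ε i x ^ 2 := rfl

theorem mEntry_eq (ε : Fin n → Fin n → ℝ → ℝ → ℝ) (s : Fin n → ℝ → ℝ) (g : Fin n → ℝ → ℝ → ℝ)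
    (i : Fin n) (x : Point n) :
    mEntry ε s g i x = -(2 * s i (x (1, i)) / u ε i x ^ 3) * dEpsU ε i x
      + g i (x (0, i)) (x (1, i)) / u ε i x ^ 2 := rfl

namespace IsSmoothData

variable {ε : Fin n → Fin n → ℝ → ℝ → ℝ} {s : Fin n → ℝ → ℝ} {g : Fin n → ℝ → ℝ → ℝ}
  {U : Set (Point n)} {x : Point n} {c : ℝ}

/-! ### Christoffel symbols of the metric -/

theorem metric_eta_eta_eta_self (h : IsSmoothData ε s g U) (hx : x ∈ U ∩ regularLocus ε)
    (i : Fin n) : christoffel (metric ε s g) (1, i) (1, i) (1, i) x =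
      dEpsBeta ε i i x + beta ε x i i * dEpsU ε i x / u ε i x
        - deriv (s i) (x (1, i)) / s i (x (1, i))
        + (deriv (fun t => g i t (x (1, i))) (x (0, i)) / 2
          + g i (x (0, i)) (x (1, i)) * beta ε x i i) / s i (x (1, i)) := by
  have hs : s i (x (1, i)) ≠ 0 := h.s_ne_zero x hx.1 i
  have hu := hx.2.2 i
  rw [christoffel_eta_eta_eta_self (h.metric_eventuallyEq hx) (h.metric_inv hx), nEntry_eq,
    h.partialDeriv_covRE_eta hx, h.partialDeriv_covEE_r hx, if_pos rfl]
  field_simp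
  ring

theorem metric_eta_eta_r (h : IsSmoothData ε s g U) (hx : x ∈ U ∩ regularLocus ε)
    {i k : Fin n} (hk : k ≠ i) : christoffel (metric ε s g) (1, i) (1, i) (0, k) x =
      u ε k x * beta ε x k i / u ε i x := by
  have hs : s i (x (1, i)) ≠ 0 := h.s_ne_zero x hx.1 i
  have hu := hx.2.2 i
  rw [christoffel_eta_eta_same (h.metric_eventuallyEq hx) (h.metric_inv hx) hk, nEntry_eq,
    h.partialDeriv_covRE_r hx]
  field_simp

theorem metric_eta_r_eta (h : IsSmoothData ε s g U) (hx : x ∈ U ∩ regularLocus ε)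
    {i k : Fin n} (hk : k ≠ i) : christoffel (metric ε s g) (1, i) (0, k) (1, i) x =
      u ε k x * beta ε x k i / u ε i x := by
  rw [← h.metric_eta_eta_r hx hk,
    christoffel_eta_same_eta (h.metric_eventuallyEq hx) (h.metric_inv hx) hk,
    christoffel_eta_eta_same (h.metric_eventuallyEq hx) (h.metric_inv hx) hk]

theorem metric_eta_eta_eta (h : IsSmoothData ε s g U) (hx : x ∈ U ∩ regularLocus ε)
    {i k : Fin n} (hk : k ≠ i) : christoffel (metric ε s g) (1, i) (1, i) (1, k) x =
      (u ε k x * dEpsBeta ε k i x + beta ε x k i * dEpsU ε k x) / u ε i x := by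
  have hs : s i (x (1, i)) ≠ 0 := h.s_ne_zero x hx.1 i
  have hu := hx.2.2 i
  rw [christoffel_eta_eta_same (h.metric_eventuallyEq hx) (h.metric_inv hx) hk, nEntry_eq,
    h.partialDeriv_covRE_eta hx, if_neg hk.symm]
  field_simp
  ring

theorem metric_eta_eta_eta' (h : IsSmoothData ε s g U) (hx : x ∈ U ∩ regularLocus ε)
    {i k : Fin n} (hk : k ≠ i) : christoffel (metric ε s g) (1, i) (1, k) (1, i) x =
      (u ε k x * dEpsBeta ε k i x + beta ε x k i * dEpsU ε k x) / u ε i x := by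
  rw [← h.metric_eta_eta_eta hx hk,
    christoffel_eta_same_eta (h.metric_eventuallyEq hx) (h.metric_inv hx) hk,
    christoffel_eta_eta_same (h.metric_eventuallyEq hx) (h.metric_inv hx) hk]

theorem metric_eta_pair (h : IsSmoothData ε s g U) (hx : x ∈ U ∩ regularLocus ε)
    {i j : Fin n} (hj : j ≠ i) : christoffel (metric ε s g) (1, i) (1, j) (0, j) x =
      -(s i (x (1, i)) * (u ε j x * beta ε x i j) / (s j (x (1, j)) * u ε i x)) := by
  have hs : s j (x (1, j)) ≠ 0 := h.s_ne_zero x hx.1 j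
  have hu := hx.2.2 i
  rw [christoffel_eta_eta_r (h.metric_eventuallyEq hx) (h.metric_inv hx) hj, nEntry_eq,
    h.partialDeriv_covRE_r hx]
  field_simp

theorem metric_eta_pair' (h : IsSmoothData ε s g U) (hx : x ∈ U ∩ regularLocus ε)
    {i j : Fin n} (hj : j ≠ i) : christoffel (metric ε s g) (1, i) (0, j) (1, j) x =
      -(s i (x (1, i)) * (u ε j x * beta ε x i j) / (s j (x (1, j)) * u ε i x)) := by
  rw [← h.metric_eta_pair hx hj,
    christoffel_eta_r_eta (h.metric_eventuallyEq hx) (h.metric_inv hx) hj,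
    christoffel_eta_eta_r (h.metric_eventuallyEq hx) (h.metric_inv hx) hj]

theorem metric_r_pair (h : IsSmoothData ε s g U) (hx : x ∈ U ∩ regularLocus ε)
    {j k : Fin n} (hj : j ≠ k) : christoffel (metric ε s g) (0, k) (1, j) (0, j) x =
      -(u ε j x / (s j (x (1, j)) * u ε k x) * (s k (x (1, k)) * dEpsBeta ε k j x
        - s k (x (1, k)) * beta ε x k j * dEpsU ε k x / u ε k x
        + g k (x (0, k)) (x (1, k)) * beta ε x k j)) := by
  have hs : s j (x (1, j)) ≠ 0 := h.s_ne_zero x hx.1 j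
  have hu := hx.2.2 k
  rw [christoffel_r_eta_r (h.metric_eventuallyEq hx) (h.metric_inv hx) hj, nEntry_eq, mEntry_eq,
    h.partialDeriv_covRE_r hx, h.partialDeriv_covRE_eta hx, if_neg hj]
  field_simp
  ring

theorem metric_r_pair_self (h : IsSmoothData ε s g U) (hx : x ∈ U ∩ regularLocus ε) (j : Fin n) :
    christoffel (metric ε s g) (0, j) (1, j) (0, j) x =
      beta ε x j j * dEpsU ε j x / u ε j x + dEpsBeta ε j j x
        - (deriv (fun t => g j t (x (1, j))) (x (0, j)) / 2
          + g j (x (0, j)) (x (1, j)) * beta ε x j j) / s j (x (1, j)) := by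
  have hs : s j (x (1, j)) ≠ 0 := h.s_ne_zero x hx.1 j
  have hu := hx.2.2 j
  rw [christoffel_r_eta_r_self (h.metric_eventuallyEq hx) (h.metric_inv hx), nEntry_eq,
    h.partialDeriv_covEE_r hx]
  field_simp

/-! ### Curvature components -/

/-- The contribution of the index `k` to the curvature components considered below. -/
def curvTerm (ε : Fin n → Fin n → ℝ → ℝ → ℝ) (s : Fin n → ℝ → ℝ) (g : Fin n → ℝ → ℝ → ℝ)
    (i j k : Fin n) (x : Point n) : ℝ :=
  g k (x (0, k)) (x (1, k)) * (beta ε x k i * beta ε x k j)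
    + s k (x (1, k)) * (dEpsBeta ε k i x * beta ε x k j + beta ε x k i * dEpsBeta ε k j x)

theorem partialDeriv_eta_eta_eta_self (h : IsSmoothData ε s g U) (hx : x ∈ U ∩ regularLocus ε)
    (i : Fin n) :
    partialDeriv (0, i) (christoffel (metric ε s g) (1, i) (1, i) (1, i)) x =
      2 * dEpsBeta ε i i x * beta ε x i i
        + (deriv (deriv fun t => g i t (x (1, i))) (x (0, i)) / 2
          + deriv (fun t => g i t (x (1, i))) (x (0, i)) * beta ε x i i
          + g i (x (0, i)) (x (1, i)) * beta ε x i i ^ 2) / s i (x (1, i)) := by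
  have hs : s i (x (1, i)) ≠ 0 := h.s_ne_zero x hx.1 i
  have hu := hx.2.2 i
  have hds : HasPartialDerivAt (fun y : Point n => deriv (s i) (y (1, i))) (0, i) 0 x := by
    refine (HasPartialDerivAt.comp_coord (φ := deriv (s i)) ?_).congr_val (by simp)
    exact (contDiffAt_deriv (h.s_smooth x hx.1 i)).differentiableAt (by simp)
  have hS := h.hasPartialDerivAt_s hx.1 i (0, i)
  have hB := h.hasPartialDerivAt_beta_r hx i i i
  have h1 := (((h.hasPartialDerivAt_dEpsBeta_r hx i i i).add
    ((hB.mul (h.hasPartialDerivAt_dEpsU_r hx i i)).div (h.hasPartialDerivAt_u_r hx i i) hu)).sub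
    (hds.div hS hs)).add
    ((((h.hasPartialDerivAt_deriv_g_r hx.1 i i).div (HasPartialDerivAt.const 2) two_ne_zero).add
      ((h.hasPartialDerivAt_g_r hx.1 i i).mul hB)).div hS hs)
  rw [partialDeriv_congr (f₂ := _) ?_, h1.2]
  · simp
    field_simp
    ring
  · filter_upwards [h.regular_mem_nhds hx] with y hy using h.metric_eta_eta_eta_self hy i

/-- All Γ^{η^i}_{r^i t} vanish, so the component is ∂Γ^{η^i}_{η^i η^i}/∂r^i minus the sum of
Γ^{η^i}_{η^i t} Γ^t_{η^i r^i}. The indices k ≠ i supply their curvature terms through this sum,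
while the term k = i and the derivatives of g_i come from the differentiated symbol. -/
theorem riemann_diag (h : IsSmoothData ε s g U) (hx : x ∈ U ∩ regularLocus ε) (i : Fin n) :
    s i (x (1, i)) * riemann (metric ε s g) (1, i) (1, i) (0, i) (1, i) x =
      ∑ k, curvTerm ε s g i i k x
        + deriv (fun t => g i t (x (1, i))) (x (0, i)) * beta ε x i i
        + deriv (deriv fun t => g i t (x (1, i))) (x (0, i)) / 2 := by
  have hs : s i (x (1, i)) ≠ 0 := h.s_ne_zero x hx.1 i
  have hu := hx.2.2 i
  have hG := h.metric_eventuallyEq hx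
  have hI := h.metric_inv hx
  have h0 : partialDeriv (1, i) (christoffel (metric ε s g) (1, i) (1, i) (0, i)) x = 0 := by
    rw [partialDeriv_congr (f₂ := fun _ => 0), partialDeriv_const]
    filter_upwards [h.regular_mem_nhds hx] with y hy using
      christoffel_eta_eta_r_self (h.metric_eventuallyEq hy) (h.metric_inv hy) i
  have hz : ∀ t, christoffel (metric ε s g) (1, i) (0, i) t x = 0 := by
    rintro ⟨b, k⟩
    fin_cases b
    · exact christoffel_eta_r_r hG hI i i k
    · by_cases hk : k = i
      · subst hk
        exact christoffel_eta_r_eta_self hG hI k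
      · exact christoffel_eta_r_eta_of_ne hG hI hk hk
  -- The contributions of r^k and η^k are paired: their parts containing `dEpsU` cancel. For k = i
  -- both products vanish, which the last summand records so that the full sum over k can be formed.
  have hsum : ∀ k, christoffel (metric ε s g) (1, i) (1, i) (0, k) x *
        christoffel (metric ε s g) (0, k) (1, i) (0, i) x
      + christoffel (metric ε s g) (1, i) (1, i) (1, k) x *
        christoffel (metric ε s g) (1, k) (1, i) (0, i) x =
      -(curvTerm ε s g i i k x / s i (x (1, i)))
        + if k = i then curvTerm ε s g i i i x / s i (x (1, i)) else 0 := by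
    intro k
    by_cases hk : k = i
    · subst hk
      rw [christoffel_eta_eta_r_self hG hI]
      simp
    · have huk := hx.2.2 k
      rw [h.metric_eta_eta_r hx hk, h.metric_r_pair hx (Ne.symm hk), h.metric_eta_eta_eta hx hk,
        h.metric_eta_pair hx (Ne.symm hk), if_neg hk, curvTerm]
      field_simp
      ring
  rw [riemann, h0, h.partialDeriv_eta_eta_eta_self hx]
  simp only [hz, zero_mul, zero_sub, Finset.sum_neg_distrib]
  rw [Fintype.sum_prod_type, Fin.sum_univ_two, ← Finset.sum_add_distrib,
    Finset.sum_congr rfl fun k _ => hsum k, Finset.sum_add_distrib, Finset.sum_neg_distrib,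
    ← Finset.sum_div]
  simp only [Finset.sum_ite_eq', Finset.mem_univ, if_true]
  generalize ∑ k, curvTerm ε s g i i k x = T
  rw [curvTerm]
  field_simp
  ring

theorem partialDeriv_eta_eta_eta (h : IsSmoothData ε s g U) (hx : x ∈ U ∩ regularLocus ε)
    {i j : Fin n} (hij : i ≠ j) :
    partialDeriv (0, j) (christoffel (metric ε s g) (1, i) (1, j) (1, i)) x =
      ((u ε j x * beta ε x j j) * dEpsBeta ε j i x + u ε j x * (dEpsBeta ε j j x * beta ε x j i)
        + beta ε x j j * beta ε x j i * dEpsU ε j x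
        + beta ε x j i * (u ε j x * dEpsBeta ε j j x)) / u ε i x
      - (u ε j x * dEpsBeta ε j i x + beta ε x j i * dEpsU ε j x) * (u ε j x * beta ε x j i)
        / u ε i x ^ 2 := by
  have hu := hx.2.2 i
  have h1 := ((((h.hasPartialDerivAt_u_r hx j j).mul
    (h.hasPartialDerivAt_dEpsBeta_r hx j i j)).add
    ((h.hasPartialDerivAt_beta_r hx j i j).mul (h.hasPartialDerivAt_dEpsU_r hx j j))).div
    (h.hasPartialDerivAt_u_r hx i j) hu)
  rw [partialDeriv_congr (f₂ := _) ?_, h1.2]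
  · field_simp
    ring
  · filter_upwards [h.regular_mem_nhds hx] with y hy using h.metric_eta_eta_eta' hy hij.symm

theorem partialDeriv_eta_pair (h : IsSmoothData ε s g U) (hx : x ∈ U ∩ regularLocus ε)
    {i j : Fin n} (hij : i ≠ j) :
    partialDeriv (1, i) (christoffel (metric ε s g) (1, i) (1, j) (0, j)) x =
      -((deriv (s i) (x (1, i)) * (u ε j x * beta ε x i j)
          + s i (x (1, i)) * ((u ε i x * dEpsBeta ε i j x + beta ε x i j * dEpsU ε i x)
              * beta ε x i j
            + u ε j x * (dEpsBeta ε i i x * beta ε x i j + beta ε x i i * dEpsBeta ε i j x)))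
          / (s j (x (1, j)) * u ε i x)
        - s i (x (1, i)) * (u ε j x * beta ε x i j)
          * (u ε i x * dEpsBeta ε i i x + beta ε x i i * dEpsU ε i x)
          / (s j (x (1, j)) * u ε i x ^ 2)) := by
  have hu := hx.2.2 i
  have hs : s j (x (1, j)) ≠ 0 := h.s_ne_zero x hx.1 j
  have h1 := (((h.hasPartialDerivAt_s hx.1 i (1, i)).mul
    ((h.hasPartialDerivAt_u_eta hx j i).mul (h.hasPartialDerivAt_beta_eta hx i j i))).div
    ((h.hasPartialDerivAt_s hx.1 j (1, i)).mul (h.hasPartialDerivAt_u_eta hx i i))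
    (mul_ne_zero hs hu)).neg
  rw [partialDeriv_congr (f₂ := _) ?_, h1.2]
  · simp [hij.symm]
    field_simp
    ring
  · filter_upwards [h.regular_mem_nhds hx] with y hy using h.metric_eta_pair hy hij.symm

/-- Indices k different from i and j contribute their curvature terms through the products of
Christoffel symbols. For k = i and k = j the products must be combined with the two differentiated
symbols; this also produces the first derivatives of g_i and g_j. -/
theorem riemann_offDiag (h : IsSmoothData ε s g U) (hx : x ∈ U ∩ regularLocus ε) {i j : Fin n}
    (hij : i ≠ j) :
    s j (x (1, j)) * u ε i x * riemann (metric ε s g) (1, i) (1, j) (0, j) (1, i) x =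
      u ε j x * (∑ k, curvTerm ε s g i j k x
        + (deriv (fun t => g i t (x (1, i))) (x (0, i))
          + deriv (fun t => g j t (x (1, j))) (x (0, j))) * beta ε x i j / 2) := by
  have hsi : s i (x (1, i)) ≠ 0 := h.s_ne_zero x hx.1 i
  have hsj : s j (x (1, j)) ≠ 0 := h.s_ne_zero x hx.1 j
  have hui := hx.2.2 i
  have huj := hx.2.2 j
  have hG := h.metric_eventuallyEq hx
  have hI := h.metric_inv hx
  set Γ := fun a b c => christoffel (metric ε s g) a b c x
  set F : Fin n → ℝ := fun k =>
    (Γ (1, i) (0, j) (0, k) * Γ (0, k) (1, j) (1, i)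
      - Γ (1, i) (1, i) (0, k) * Γ (0, k) (1, j) (0, j))
    + (Γ (1, i) (0, j) (1, k) * Γ (1, k) (1, j) (1, i)
      - Γ (1, i) (1, i) (1, k) * Γ (1, k) (1, j) (0, j))
  set C := u ε j x / (u ε i x * s j (x (1, j)))
  -- The generic formula is summed over all k, with corrections at the two exceptional indices.
  have hsum : ∀ k, F k = C * curvTerm ε s g i j k x
      + (if k = i then F i - C * curvTerm ε s g i j i x else 0)
      + (if k = j then F j - C * curvTerm ε s g i j j x else 0) := by
    intro k
    by_cases hki : k = i
    · subst hki
      simp [hij]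
    by_cases hkj : k = j
    · subst hkj
      simp [hki]
    have huk := hx.2.2 k
    simp only [F, Γ, C]
    rw [christoffel_eta_r_r hG hI, christoffel_eta_r_eta_of_ne hG hI hki hkj,
      h.metric_eta_eta_r hx hki, h.metric_r_pair hx (Ne.symm hkj), h.metric_eta_eta_eta hx hki,
      h.metric_eta_pair hx (Ne.symm hkj), if_neg hki, if_neg hkj, curvTerm]
    field_simp
    ring
  have hFi : F i = (u ε j x * beta ε x j i / u ε i x)
        * ((u ε j x * dEpsBeta ε j i x + beta ε x j i * dEpsU ε j x) / u ε i x)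
      - (dEpsBeta ε i i x + beta ε x i i * dEpsU ε i x / u ε i x
        - deriv (s i) (x (1, i)) / s i (x (1, i))
        + (deriv (fun t => g i t (x (1, i))) (x (0, i)) / 2
          + g i (x (0, i)) (x (1, i)) * beta ε x i i) / s i (x (1, i)))
        * -(s i (x (1, i)) * (u ε j x * beta ε x i j) / (s j (x (1, j)) * u ε i x)) := by
    simp only [F, Γ]
    rw [christoffel_eta_r_r hG hI, christoffel_eta_eta_r_self hG hI, h.metric_eta_r_eta hx hij.symm,
      h.metric_eta_eta_eta' hx hij.symm, h.metric_eta_eta_eta_self hx,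
      h.metric_eta_pair hx hij.symm]
    ring
  have hFj : F j = -((u ε j x * beta ε x j i / u ε i x) *
        (beta ε x j j * dEpsU ε j x / u ε j x + dEpsBeta ε j j x
        - (deriv (fun t => g j t (x (1, j))) (x (0, j)) / 2
          + g j (x (0, j)) (x (1, j)) * beta ε x j j) / s j (x (1, j))))
      + -(s i (x (1, i)) * (u ε j x * beta ε x i j) / (s j (x (1, j)) * u ε i x))
        * ((u ε i x * dEpsBeta ε i j x + beta ε x i j * dEpsU ε i x) / u ε j x) := by
    simp only [F, Γ]
    rw [christoffel_eta_r_r hG hI, h.metric_eta_eta_r hx hij.symm, h.metric_r_pair_self hx,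
      h.metric_eta_pair' hx hij.symm, h.metric_eta_eta_eta hx hij,
      christoffel_eta_eta_r_self hG hI]
    ring
  have hR : riemann (metric ε s g) (1, i) (1, j) (0, j) (1, i) x =
      partialDeriv (0, j) (christoffel (metric ε s g) (1, i) (1, j) (1, i)) x
        - partialDeriv (1, i) (christoffel (metric ε s g) (1, i) (1, j) (0, j)) x + ∑ k, F k := by
    rw [riemann, Fintype.sum_prod_type, Fin.sum_univ_two, ← Finset.sum_add_distrib]
  rw [hR, h.partialDeriv_eta_eta_eta hx hij, h.partialDeriv_eta_pair hx hij,
    Finset.sum_congr rfl fun k _ => hsum k, Finset.sum_add_distrib, Finset.sum_add_distrib,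
    ← Finset.mul_sum]
  simp only [Finset.sum_ite_eq', Finset.mem_univ, if_true]
  rw [hFi, hFj]
  generalize ∑ k, curvTerm ε s g i j k x = T
  rw [curvTerm, curvTerm, h.beta_symm hx.1 j i]
  simp only [C]
  field_simp
  ring

/-! ### Consequences of constant curvature -/

/-- In R^{η^i}_{η^j r^j η^i} the first Kronecker delta is zero and the second is one, so constant
curvature makes it -c g_{η^j r^j} = -c (u^j)²/s_j. The rest is cancellation of nonzero factors. -/
theorem sum_curvTerm (h : IsSmoothData ε s g U)
    (hc : HasConstantCurvatureOn (metric ε s g) c (U ∩ regularLocus ε))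
    (hx : x ∈ U ∩ regularLocus ε) (i j : Fin n) :
    ∑ k, curvTerm ε s g i j k x
        + (deriv (fun t => g i t (x (1, i))) (x (0, i))
          + deriv (fun t => g j t (x (1, j))) (x (0, j))) * beta ε x i j / 2
        + (if i = j then deriv (deriv fun t => g i t (x (1, i))) (x (0, i)) / 2 else 0) =
      -c * (u ε i x * u ε j x) := by
  have hsj : s j (x (1, j)) ≠ 0 := h.s_ne_zero x hx.1 j
  have huj := hx.2.2 j
  have hm : metric ε s g x (1, j) (0, j) = u ε j x * u ε j x / s j (x (1, j)) := by
    rw [h.metric_eq hx]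
    simp [hankelBlocks, Matrix.blockDiagonal_apply, covRE]
  have hR := hc x hx (1, i) (1, j) (0, j) (1, i)
  simp only [Matrix.one_apply, Prod.mk.injEq, one_ne_zero, false_and, if_false, if_true,
    hm] at hR
  by_cases hij : i = j
  · subst hij
    have h1 := h.riemann_diag hx i
    rw [hR] at h1
    field_simp at h1
    rw [if_pos rfl]
    linear_combination -(1 / 2) * h1
  · have h1 := h.riemann_offDiag hx hij
    rw [hR] at h1
    rw [if_neg hij]
    apply mul_left_cancel₀ huj
    field_simp at h1
    linear_combination -(1 / 2) * h1

/-- The matrix with entries `s_i ε^{ij}_{,η^i}` off the diagonal. -/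
def sDEps (ε : Fin n → Fin n → ℝ → ℝ → ℝ) (s : Fin n → ℝ → ℝ) (x : Point n) :
    Matrix (Fin n) (Fin n) ℝ :=
  Matrix.of fun i j => if j ≠ i then s i (x (1, i)) * epsD₂ ε j i x else 0

theorem structure_eq_of_regular (h : IsSmoothData ε s g U)
    (hc : HasConstantCurvatureOn (metric ε s g) c (U ∩ regularLocus ε))
    (hx : x ∈ U ∩ regularLocus ε) (i j : Fin n) :
    (if i = j then g i (x (0, i)) (x (1, i)) else 0) + (sDEps ε s x i j + sDEps ε s x j i)
      - epsHat ε x i j * (deriv (fun t => g i t (x (1, i))) (x (0, i))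
          + deriv (fun t => g j t (x (1, j))) (x (0, j))) / 2
      + (∑ k, epsHat ε x i k * deriv (deriv fun t => g k t (x (1, k))) (x (0, k))
          * epsHat ε x k j) / 2 = -c := by
  set β := beta ε x
  set e := epsHat ε x
  set Q := sDEps ε s x
  set D := Matrix.diagonal fun k => g k (x (0, k)) (x (1, k))
  set D₁ := Matrix.diagonal fun k => deriv (fun t => g k t (x (1, k))) (x (0, k)) with hD₁
  set D₂ := Matrix.diagonal fun k =>
    deriv (deriv fun t => g k t (x (1, k))) (x (0, k)) with hD₂
  let J : Matrix (Fin n) (Fin n) ℝ := Matrix.of fun _ _ => 1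
  have hβ : β.transpose = β := by
    ext a b
    exact h.beta_symm hx.1 b a
  have he : e * β = -1 := epsHat_mul_beta hx.2
  have he' : β * e = -1 := beta_mul_epsHat hx.2
  have hQ : ∀ k l, (Q * β) k l = s k (x (1, k)) * dEpsBeta ε k l x := by
    intro k l
    simp only [Q, β, sDEps, Matrix.mul_apply, Matrix.of_apply, dEpsBeta, Finset.sum_filter,
      Finset.mul_sum]
    refine Finset.sum_congr rfl fun a _ => ?_
    split_ifs <;> ring
  have hQ' : ∀ k l, (β * Q.transpose) k l = s l (x (1, l)) * dEpsBeta ε l k x := by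
    intro k l
    rw [← hQ, ← hβ, ← Matrix.transpose_mul, Matrix.transpose_apply, hβ]
  -- The entrywise curvature equations in matrix form; u^a u^b is the (a, b) entry of βJβ because
  -- u^a is the a-th row sum of β.
  have hK : β * D * β + β * Q * β + β * Q.transpose * β + (1 / 2 : ℝ) • (D₁ * β + β * D₁)
      + (1 / 2 : ℝ) • D₂ = -c • (β * J * β) := by
    ext a b
    have h1 := h.sum_curvTerm hc hx a b
    have hJ : (β * J * β) a b = u ε a x * u ε b x := by
      simp only [J, Matrix.mul_apply, Matrix.of_apply, mul_one]
      rw [← Finset.mul_sum, h.sum_beta_row hx.1]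
      rfl
    have hT : ∑ k, curvTerm ε s g a b k x =
        (β * D * β) a b + (β * Q * β) a b + (β * Q.transpose * β) a b := by
      rw [mul_assoc β Q β]
      simp only [Matrix.mul_apply (M := β * D), Matrix.mul_apply (M := β) (N := Q * β),
        Matrix.mul_apply (M := β * Q.transpose), hQ, hQ', D, Matrix.mul_diagonal]
      rw [← Finset.sum_add_distrib, ← Finset.sum_add_distrib]
      refine Finset.sum_congr rfl fun k _ => ?_
      simp only [curvTerm, β]
      rw [h.beta_symm hx.1 k a]
      ring
    simp only [Matrix.add_apply, Matrix.smul_apply, hJ, smul_eq_mul, hD₁, hD₂,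
      Matrix.diagonal_mul, Matrix.mul_diagonal, Matrix.diagonal_apply, ← hT]
    rw [← h1]
    split_ifs <;> ring
  -- Multiplication by e on both sides undoes the sandwich between two copies of β; the two signs
  -- from eβ = βe = -1 cancel. Terms with only one β acquire a minus sign.
  have hE : D + Q + Q.transpose - (1 / 2 : ℝ) • (e * D₁ + D₁ * e) + (1 / 2 : ℝ) • (e * D₂ * e) =
      -c • J := by
    have h1 := congrArg (fun M => e * M * e) hK
    have hs : ∀ M : Matrix (Fin n) (Fin n) ℝ, e * (β * M * β) * e = M := by
      intro M
      calc e * (β * M * β) * e = (e * β) * M * (β * e) := by simp only [mul_assoc]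
        _ = M := by rw [he, he']; simp
    have hs1 : e * (D₁ * β) * e = -(e * D₁) := by
      rw [mul_assoc, mul_assoc, he', ← mul_assoc]; simp
    have hs2 : e * (β * D₁) * e = -(D₁ * e) := by
      rw [← mul_assoc, he]; simp
    simp only [mul_add, add_mul, Matrix.mul_smul, Matrix.smul_mul, hs, hs1, hs2] at h1
    rw [← h1, smul_add, smul_add, smul_neg, smul_neg]
    abel
  have h2 := congrFun (congrFun hE i) j
  simp only [Matrix.add_apply, Matrix.sub_apply, Matrix.smul_apply, smul_eq_mul, hD₁, hD₂,
    Matrix.diagonal_mul, Matrix.mul_diagonal, Matrix.diagonal_apply, Matrix.transpose_apply,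
    Matrix.of_apply, D, J, Matrix.mul_apply (M := e * _)] at h2
  linear_combination h2

/-! ### Density of the regular locus -/

/-- The point obtained by adding `t` to every `r^i`. -/
def shift (x : Point n) (t : ℝ) : Point n := fun p => x p + if p.1 = 0 then t else 0

theorem epsHat_shift (ε : Fin n → Fin n → ℝ → ℝ → ℝ) (x : Point n) (t : ℝ) :
    epsHat ε (shift x t) = epsHat ε x + t • (1 : Matrix (Fin n) (Fin n) ℝ) := by
  ext i j
  by_cases hij : i = j
  · simp [epsHat, shift, Point.r, hij]
  · simp [epsHat, shift, eps, Point.eta, hij]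

/-- With τ = 1/t the shifted matrix is M + t = t(1 + τM). Its regularity amounts to the nonvanishing
of det(1 + τM) and of the column sums of adj(1 + τM). These are polynomials in τ with value 1 at τ =
0, hence nonzero, so only finitely many t are excluded. -/
theorem eventually_shift_regular (ε : Fin n → Fin n → ℝ → ℝ → ℝ) (x : Point n) :
    ∀ᶠ t in 𝓝[≠] (0 : ℝ), shift x t ∈ regularLocus ε := by
  set M := epsHat ε x
  let P : Matrix (Fin n) (Fin n) (Polynomial ℝ) :=
    1 + (Polynomial.X : Polynomial ℝ) • M.map Polynomial.C
  have hP : ∀ τ : ℝ, P.map (Polynomial.evalRingHom τ) = 1 + τ • M := by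
    intro τ
    ext i j
    simp [P, Matrix.one_apply, apply_ite (Polynomial.eval τ)]
    ring
  have hdet : ∀ τ : ℝ, P.det.eval τ = (1 + τ • M).det := by
    intro τ
    rw [← hP, ← RingHom.mapMatrix_apply, ← RingHom.map_det, Polynomial.coe_evalRingHom]
  have hadj : ∀ (τ : ℝ) (i : Fin n), (∑ k, P.adjugate k i).eval τ =
      ∑ k, (1 + τ • M).adjugate k i := by
    intro τ i
    rw [← hP, ← RingHom.mapMatrix_apply, ← RingHom.map_adjugate, Polynomial.eval_finsetSum]
    rfl
  have hne : ∀ p : Polynomial ℝ, p.eval 0 = 1 → ∀ᶠ t in 𝓝[≠] (0 : ℝ), p.eval t⁻¹ ≠ 0 := by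
    intro p hp
    have hp0 : p ≠ 0 := by
      rintro rfl
      simp at hp
    have hfin : {t : ℝ | p.eval t⁻¹ = 0}.Finite := by
      refine Set.Finite.subset
        ((p.roots.toFinset.finite_toSet).preimage (inv_injective.injOn)) ?_
      intro t ht
      simpa [hp0] using ht
    exact nhdsNE_le_cofinite 0 hfin.compl_mem_cofinite
  have h1 := hne P.det (by rw [hdet]; simp)
  have h2 : ∀ᶠ t in 𝓝[≠] (0 : ℝ), ∀ i, (∑ k, P.adjugate k i).eval t⁻¹ ≠ 0 :=
    Filter.eventually_all.2 fun i => hne _ (by rw [hadj]; simp [Matrix.one_apply])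
  filter_upwards [h1, h2, self_mem_nhdsWithin] with t h1 h2 ht
  have ht : t ≠ 0 := ht
  rw [hdet] at h1
  have he : epsHat ε (shift x t) = t • (1 + t⁻¹ • M) := by
    rw [epsHat_shift, smul_add, smul_smul, mul_inv_cancel₀ ht, one_smul, add_comm]
  have hdet' : (epsHat ε (shift x t)).det ≠ 0 := by
    rw [he, Matrix.det_smul]
    exact mul_ne_zero (pow_ne_zero _ ht) h1
  refine ⟨hdet', fun i => ?_⟩
  have h3 := h2 i
  rw [hadj] at h3
  have hinv : (epsHat ε (shift x t))⁻¹ = t⁻¹ • (1 + t⁻¹ • M)⁻¹ := by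
    rw [he]
    refine Matrix.inv_eq_right_inv ?_
    rw [Matrix.smul_mul, Matrix.mul_smul, smul_smul, mul_inv_cancel₀ ht, one_smul,
      Matrix.mul_nonsing_inv _ (isUnit_iff_ne_zero.2 h1)]
  simp only [u, beta, hinv, Matrix.inv_def, Ring.inverse_eq_inv', Matrix.neg_apply,
    Matrix.smul_apply, smul_eq_mul, Finset.sum_neg_distrib, ← Finset.mul_sum]
  exact neg_ne_zero.2 (mul_ne_zero (inv_ne_zero ht) (mul_ne_zero (inv_ne_zero h1) h3))

theorem continuous_shift (x : Point n) : Continuous (shift x) := by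
  refine continuous_pi fun p => ?_
  simp only [shift]
  split_ifs <;> fun_prop

theorem shift_zero (x : Point n) : shift x 0 = x := by
  ext p
  simp [shift]

theorem contDiffAt_slice (h : IsSmoothData ε s g U) (hx : x ∈ U) (i : Fin n) :
    ContDiffAt ℝ ∞ (fun t => g i t (x (1, i))) (x (0, i)) :=
  ContDiffAt.comp (x (0, i)) (f := fun t => (t, x (1, i))) (h.g_smooth x hx i)
    (contDiffAt_id.prodMk contDiffAt_const)

/-- The left side involves no inverse and is continuous along the shift of x, which fixes every η^k.
It equals -c for all small t ≠ 0, hence also at t = 0. -/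
theorem structure_eq (h : IsSmoothData ε s g U)
    (hc : HasConstantCurvatureOn (metric ε s g) c (U ∩ regularLocus ε))
    (hx : x ∈ U) (i j : Fin n) :
    (if i = j then g i (x (0, i)) (x (1, i)) else 0) + (sDEps ε s x i j + sDEps ε s x j i)
      - epsHat ε x i j * (deriv (fun t => g i t (x (1, i))) (x (0, i))
          + deriv (fun t => g j t (x (1, j))) (x (0, j))) / 2
      + (∑ k, epsHat ε x i k * deriv (deriv fun t => g k t (x (1, k))) (x (0, k))
          * epsHat ε x k j) / 2 = -c := by
  let L : Point n → ℝ := fun y =>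
    (if i = j then g i (y (0, i)) (y (1, i)) else 0) + (sDEps ε s y i j + sDEps ε s y j i)
      - epsHat ε y i j * (deriv (fun t => g i t (y (1, i))) (y (0, i))
          + deriv (fun t => g j t (y (1, j))) (y (0, j))) / 2
      + (∑ k, epsHat ε y i k * deriv (deriv fun t => g k t (y (1, k))) (y (0, k))
          * epsHat ε y k j) / 2
  have hr : ∀ k, (fun t => shift x t (0, k)) = fun t => x (0, k) + t := fun k => by
    ext t; simp [shift]
  have hη : ∀ k t, shift x t (1, k) = x (1, k) := fun k t => by simp [shift]
  have hcomp : ∀ (k : Fin n) (f : ℝ → ℝ), ContDiffAt ℝ ∞ f (x (0, k)) →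
      ContinuousAt (fun t => f (shift x t (0, k))) 0 := by
    intro k f hf
    have h1 : ContinuousAt (fun t => shift x t (0, k)) 0 :=
      ((continuous_apply (0, k)).comp (continuous_shift x)).continuousAt
    refine ContinuousAt.comp (g := f) ?_ h1
    rw [shift_zero]
    exact hf.continuousAt
  have he : ∀ a b, ContinuousAt (fun t => epsHat ε (shift x t) a b) 0 := by
    intro a b
    simp only [epsHat_shift, Matrix.add_apply, Matrix.smul_apply, smul_eq_mul]
    fun_prop
  have hS : ∀ a b t, sDEps ε s (shift x t) a b = sDEps ε s x a b := by
    intro a b t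
    simp only [sDEps, Matrix.of_apply, epsD₂, Point.eta, hη]
  have hL : ContinuousAt (fun t => L (shift x t)) 0 := by
    have g1 := fun k => contDiffAt_deriv (h.contDiffAt_slice hx k)
    simp only [L, hS, hη]
    refine ContinuousAt.add (ContinuousAt.sub (ContinuousAt.add ?_ continuousAt_const) ?_) ?_
    · split_ifs
      · exact hcomp i _ (h.contDiffAt_slice hx i)
      · exact continuousAt_const
    · exact ((he i j).mul ((hcomp i _ (g1 i)).add (hcomp j _ (g1 j)))).div_const 2
    · refine ContinuousAt.div_const (tendsto_finsetSum _ fun k _ => ?_) 2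
      exact ((he i k).mul (hcomp k _ (contDiffAt_deriv (g1 k)))).mul (he k j)
  have hev : ∀ᶠ t in 𝓝[≠] (0 : ℝ), L (shift x t) = -c := by
    have hU : ∀ᶠ t in 𝓝[≠] (0 : ℝ), shift x t ∈ U :=
      ((continuous_shift x).continuousAt.eventually
        (h.isOpen.mem_nhds (by rwa [shift_zero]))).filter_mono nhdsWithin_le_nhds
    filter_upwards [hU, eventually_shift_regular ε x] with t h1 h2
    exact h.structure_eq_of_regular hc ⟨h1, h2⟩ i j
  have h1 : Filter.Tendsto (fun t => L (shift x t)) (𝓝[≠] 0) (𝓝 (L (shift x 0))) :=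
    hL.tendsto.mono_left nhdsWithin_le_nhds
  have h2 : Filter.Tendsto (fun t => L (shift x t)) (𝓝[≠] 0) (𝓝 (-c)) :=
    tendsto_const_nhds.congr' (hev.mono fun t ht => ht.symm)
  have h3 := tendsto_nhds_unique h1 h2
  rwa [shift_zero] at h3

/-! ### Quadratic dependence on `r` -/

theorem structure_eq_diag (h : IsSmoothData ε s g U)
    (hc : HasConstantCurvatureOn (metric ε s g) c (U ∩ regularLocus ε))
    (hx : x ∈ U) (i : Fin n) :
    g i (x (0, i)) (x (1, i)) - x (0, i) * deriv (fun t => g i t (x (1, i))) (x (0, i))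
      + x (0, i) ^ 2 * deriv (deriv fun t => g i t (x (1, i))) (x (0, i)) / 2
      + ∑ k with k ≠ i, deriv (deriv fun t => g k t (x (1, k))) (x (0, k)) / 2 * eps ε i k x ^ 2
      = -c := by
  have h1 := h.structure_eq hc hx i i
  have h2 : ∑ k, epsHat ε x i k * deriv (deriv fun t => g k t (x (1, k))) (x (0, k))
      * epsHat ε x k i = x (0, i) ^ 2 * deriv (deriv fun t => g i t (x (1, i))) (x (0, i))
      + 2 * ∑ k with k ≠ i,
        deriv (deriv fun t => g k t (x (1, k))) (x (0, k)) / 2 * eps ε i k x ^ 2 := by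
    rw [← Finset.add_sum_erase _ _ (Finset.mem_univ i), ← Finset.filter_ne', Finset.mul_sum]
    congr 1
    · simp [epsHat, Point.r]
      ring
    · refine Finset.sum_congr rfl fun k hk => ?_
      have hk : k ≠ i := (Finset.mem_filter.1 hk).2
      simp only [epsHat, Matrix.of_apply, if_neg hk, if_neg hk.symm]
      rw [h.symm x hx k i hk]
      ring
  have h3 : epsHat ε x i i = x (0, i) := by simp [epsHat, Point.r]
  have h4 : sDEps ε s x i i = 0 := by simp [sDEps]
  rw [h2, h3, h4, if_pos rfl] at h1
  linear_combination h1

/-! ### Vanishing of the third r-derivative of g_i. -/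

theorem eventually_update_mem (h : IsSmoothData ε s g U) (hx : x ∈ U) (p : Fin 2 × Fin n) :
    ∀ᶠ t in 𝓝 (x p), Function.update x p t ∈ U :=
  (continuous_const.update p continuous_id).continuousAt.eventually
    (h.isOpen.mem_nhds (by simpa using hx))

/-- Differentiate the diagonal equation in r^i. The sum over k ≠ i is independent of r^i, and the
derivative of g - r g' + r² g''/2 telescopes to r² g'''/2. -/
theorem sq_mul_deriv_three (h : IsSmoothData ε s g U)
    (hc : HasConstantCurvatureOn (metric ε s g) c (U ∩ regularLocus ε))
    (hx : x ∈ U) (i : Fin n) :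
    x (0, i) ^ 2 * deriv (deriv (deriv fun t => g i t (x (1, i)))) (x (0, i)) = 0 := by
  set γ : ℝ → ℝ := fun t => g i t (x (1, i))
  have hγ : ContDiffAt ℝ ∞ γ (x (0, i)) := h.contDiffAt_slice hx i
  have d0 := (hγ.differentiableAt (by simp)).hasDerivAt
  have d1 := ((contDiffAt_deriv hγ).differentiableAt (by simp)).hasDerivAt
  have d2 := ((contDiffAt_deriv (contDiffAt_deriv hγ)).differentiableAt (by simp)).hasDerivAt
  have hid := hasDerivAt_id (x (0, i))
  have hF := (d0.sub (hid.mul d1)).add (((hid.pow 2).mul d2).div_const 2)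
  set K := ∑ k with k ≠ i,
    deriv (deriv fun t => g k t (x (1, k))) (x (0, k)) / 2 * eps ε i k x ^ 2
  have hconst : HasDerivAt (fun _ : ℝ => -c - K) 0 (x (0, i)) := hasDerivAt_const _ _
  have := hF.unique (hconst.congr_of_eventuallyEq ?_)
  · simp at this
    linear_combination 2 * this
  filter_upwards [h.eventually_update_mem hx (0, i)] with t ht
  have h1 := h.structure_eq_diag hc ht i
  have hK : ∑ k with k ≠ i, deriv (deriv fun τ => g k τ (Function.update x (0, i) t (1, k)))
      (Function.update x (0, i) t (0, k)) / 2 * eps ε i k (Function.update x (0, i) t) ^ 2 = K := by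
    refine Finset.sum_congr rfl fun k hk => ?_
    have hk : k ≠ i := (Finset.mem_filter.1 hk).2
    simp [eps, Point.eta, hk]
  rw [hK] at h1
  simp at h1 ⊢
  linear_combination h1

theorem deriv_three_eq_zero (h : IsSmoothData ε s g U)
    (hc : HasConstantCurvatureOn (metric ε s g) c (U ∩ regularLocus ε))
    (hx : x ∈ U) (i : Fin n) :
    deriv (deriv (deriv fun t => g i t (x (1, i)))) (x (0, i)) = 0 := by
  set f := deriv (deriv (deriv fun t => g i t (x (1, i))))
  have hf : ContinuousAt f (x (0, i)) :=
    (contDiffAt_deriv (contDiffAt_deriv (contDiffAt_deriv (h.contDiffAt_slice hx i)))).continuousAt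
  -- The factor r² gives no information at r^i = 0; there the vanishing at nearby nonzero r^i passes
  -- to the limit.
  by_cases h0 : x (0, i) = 0
  · have hev : ∀ᶠ t in 𝓝[≠] (x (0, i)), f t = 0 := by
      filter_upwards [(h.eventually_update_mem hx (0, i)).filter_mono nhdsWithin_le_nhds,
        self_mem_nhdsWithin] with t ht htne
      have ht0 : t ≠ 0 := fun hh => htne (by simp [hh, h0])
      have := h.sq_mul_deriv_three hc ht i
      simpa [ht0] using this
    exact tendsto_nhds_unique (hf.tendsto.mono_left nhdsWithin_le_nhds)
      (tendsto_const_nhds.congr' (hev.mono fun t ht => ht.symm))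
  · have := h.sq_mul_deriv_three hc hx i
    exact (mul_eq_zero.1 this).resolve_left (pow_ne_zero 2 h0)

/-! ### The coefficients of g_i as functions of η^i alone. -/

/-- The values of `r^i` on the part of `U` where `η^i = y`. -/
def rValues (U : Set (Point n)) (i : Fin n) (y : ℝ) : Set ℝ :=
  {ρ : ℝ | ∃ x ∈ U, x.r i = ρ ∧ x.eta i = y}

theorem isOpen_rValues (h : IsSmoothData ε s g U) (i : Fin n) (y : ℝ) :
    IsOpen (rValues U i y) := by
  rw [isOpen_iff_mem_nhds]
  rintro ρ ⟨x, hx, rfl, rfl⟩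
  filter_upwards [h.eventually_update_mem hx (0, i)] with t ht
  exact ⟨_, ht, by simp [Point.r], by simp [Point.eta]⟩

/-- A chosen value of `r^i` on the part of `U` where `η^i = y`, if there is any. -/
def basePoint (U : Set (Point n)) (i : Fin n) (y : ℝ) : ℝ :=
  Classical.epsilon fun ρ => ρ ∈ rValues U i y

/-- A function of `r^i` with vanishing derivative is constant on the slices `η^i = y` of `U`. -/
theorem eq_basePoint (h : IsSmoothData ε s g U)
    (hconn : ∀ (i : Fin n) (y : ℝ), IsPreconnected (rValues U i y)) (i : Fin n) (F : ℝ → ℝ)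
    (hx : x ∈ U) (hF : ∀ ρ ∈ rValues U i (x (1, i)), HasDerivAt F 0 ρ) :
    F (basePoint U i (x (1, i))) = F (x (0, i)) := by
  have hm : x (0, i) ∈ rValues U i (x (1, i)) := ⟨x, hx, rfl, rfl⟩
  have hb : basePoint U i (x (1, i)) ∈ rValues U i (x (1, i)) :=
    Classical.epsilon_spec (p := fun ρ => ρ ∈ rValues U i (x (1, i))) ⟨_, hm⟩
  exact (h.isOpen_rValues i _).is_const_of_deriv_eq_zero (hconn i _)
    (fun ρ hρ => (hF ρ hρ).differentiableAt.differentiableWithinAt)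
    (fun ρ hρ => (hF ρ hρ).deriv) hb hm

/-- Each value in the slice is attained at some point of U with the same η^i, so smoothness and g'''
= 0 hold along the whole slice, with the other coordinates free to vary. -/
theorem hasDerivAt_slice (h : IsSmoothData ε s g U)
    (hc : HasConstantCurvatureOn (metric ε s g) c (U ∩ regularLocus ε)) {i : Fin n} {y ρ : ℝ}
    (hρ : ρ ∈ rValues U i y) :
    HasDerivAt (fun t => g i t y) (deriv (fun t => g i t y) ρ) ρ ∧
    HasDerivAt (deriv fun t => g i t y) (deriv (deriv fun t => g i t y) ρ) ρ ∧
    HasDerivAt (deriv (deriv fun t => g i t y)) 0 ρ := by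
  obtain ⟨x, hx, rfl, rfl⟩ := hρ
  have h0 := h.contDiffAt_slice hx i
  have h1 := contDiffAt_deriv h0
  have h2 := contDiffAt_deriv h1
  refine ⟨(h0.differentiableAt (by simp)).hasDerivAt,
    (h1.differentiableAt (by simp)).hasDerivAt, ?_⟩
  rw [← h.deriv_three_eq_zero hc hx i]
  exact (h2.differentiableAt (by simp)).hasDerivAt

/-- The coefficient of `(r^i)^2` in `g_i`. -/
def quadCoeff (g : Fin n → ℝ → ℝ → ℝ) (U : Set (Point n)) (i : Fin n) (y : ℝ) : ℝ :=
  deriv (deriv fun t => g i t y) (basePoint U i y) / 2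

/-- The coefficient of `r^i` in `g_i`. -/
def linCoeff (g : Fin n → ℝ → ℝ → ℝ) (U : Set (Point n)) (i : Fin n) (y : ℝ) : ℝ :=
  deriv (fun t => g i t y) (basePoint U i y)
    - basePoint U i y * deriv (deriv fun t => g i t y) (basePoint U i y)

/-- The coefficient of `1` in `g_i`. -/
def constCoeff (g : Fin n → ℝ → ℝ → ℝ) (U : Set (Point n)) (i : Fin n) (y : ℝ) : ℝ :=
  g i (basePoint U i y) y - basePoint U i y * deriv (fun t => g i t y) (basePoint U i y)
    + basePoint U i y ^ 2 * deriv (deriv fun t => g i t y) (basePoint U i y) / 2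

/-- Here and in the two lemmas after it, the r-derivative of the right side is a multiple of g'''
and so vanishes. The value at the chosen base point therefore agrees with the value at any point of
U with the same η^i. -/
theorem quadCoeff_eq (h : IsSmoothData ε s g U)
    (hconn : ∀ (i : Fin n) (y : ℝ), IsPreconnected (rValues U i y))
    (hc : HasConstantCurvatureOn (metric ε s g) c (U ∩ regularLocus ε)) (hx : x ∈ U) (i : Fin n) :
    quadCoeff g U i (x (1, i)) = deriv (deriv fun t => g i t (x (1, i))) (x (0, i)) / 2 := by
  refine h.eq_basePoint hconn i (fun ρ => deriv (deriv fun t => g i t (x (1, i))) ρ / 2) hx ?_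
  intro ρ hρ
  simpa using (h.hasDerivAt_slice hc hρ).2.2.div_const 2

theorem linCoeff_eq (h : IsSmoothData ε s g U)
    (hconn : ∀ (i : Fin n) (y : ℝ), IsPreconnected (rValues U i y))
    (hc : HasConstantCurvatureOn (metric ε s g) c (U ∩ regularLocus ε)) (hx : x ∈ U) (i : Fin n) :
    linCoeff g U i (x (1, i)) = deriv (fun t => g i t (x (1, i))) (x (0, i))
      - x (0, i) * deriv (deriv fun t => g i t (x (1, i))) (x (0, i)) := by
  refine h.eq_basePoint hconn i (fun ρ => deriv (fun t => g i t (x (1, i))) ρ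
    - ρ * deriv (deriv fun t => g i t (x (1, i))) ρ) hx ?_
  intro ρ hρ
  obtain ⟨-, h1, h2⟩ := h.hasDerivAt_slice hc hρ
  simpa using h1.fun_sub ((hasDerivAt_id' ρ).fun_mul h2)

theorem constCoeff_eq (h : IsSmoothData ε s g U)
    (hconn : ∀ (i : Fin n) (y : ℝ), IsPreconnected (rValues U i y))
    (hc : HasConstantCurvatureOn (metric ε s g) c (U ∩ regularLocus ε)) (hx : x ∈ U) (i : Fin n) :
    constCoeff g U i (x (1, i)) = g i (x (0, i)) (x (1, i))
      - x (0, i) * deriv (fun t => g i t (x (1, i))) (x (0, i))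
      + x (0, i) ^ 2 * deriv (deriv fun t => g i t (x (1, i))) (x (0, i)) / 2 := by
  refine h.eq_basePoint hconn i (fun ρ => g i ρ (x (1, i))
    - ρ * deriv (fun t => g i t (x (1, i))) ρ
    + ρ ^ 2 * deriv (deriv fun t => g i t (x (1, i))) ρ / 2) hx ?_
  intro ρ hρ
  obtain ⟨h0, h1, h2⟩ := h.hasDerivAt_slice hc hρ
  have hid := hasDerivAt_id' ρ
  refine ((h0.fun_sub (hid.fun_mul h1)).fun_add
    (((hid.fun_pow 2).fun_mul h2).div_const 2)).congr_deriv ?_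
  push_cast
  ring

/-- In the (i, j) entry of eD₂e/2 the terms k = i and k = j are ε^{ij} r^i g_i''/2 and ε^{ij} r^j
g_j''/2. Combined with the first derivatives, they form the r-independent expressions g' - r g''. -/
theorem structure_eq_offDiag (h : IsSmoothData ε s g U)
    (hc : HasConstantCurvatureOn (metric ε s g) c (U ∩ regularLocus ε))
    (hx : x ∈ U) {i j : Fin n} (hij : i ≠ j) :
    s i (x (1, i)) * epsD₁ ε i j x + s j (x (1, j)) * epsD₂ ε i j x
      - eps ε i j x * ((deriv (fun t => g i t (x (1, i))) (x (0, i))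
          - x (0, i) * deriv (deriv fun t => g i t (x (1, i))) (x (0, i)))
        + (deriv (fun t => g j t (x (1, j))) (x (0, j))
          - x (0, j) * deriv (deriv fun t => g j t (x (1, j))) (x (0, j)))) / 2
      + ∑ k with k ≠ i ∧ k ≠ j,
        eps ε i k x * eps ε j k x * (deriv (deriv fun t => g k t (x (1, k))) (x (0, k)) / 2)
      = -c := by
  have h1 := h.structure_eq hc hx i j
  have hsplit : ∀ f : Fin n → ℝ, ∑ k, f k = f i + f j + ∑ k with k ≠ i ∧ k ≠ j, f k := by
    intro f
    rw [← Finset.add_sum_erase _ _ (Finset.mem_univ i),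
      ← Finset.add_sum_erase _ _ (Finset.mem_erase.2 ⟨hij.symm, Finset.mem_univ j⟩), add_assoc]
    congr 3
    ext k
    simp [and_comm]
  have h2 : ∑ k with k ≠ i ∧ k ≠ j,
      epsHat ε x i k * deriv (deriv fun t => g k t (x (1, k))) (x (0, k)) * epsHat ε x k j =
      2 * ∑ k with k ≠ i ∧ k ≠ j,
        eps ε i k x * eps ε j k x * (deriv (deriv fun t => g k t (x (1, k))) (x (0, k)) / 2) := by
    rw [Finset.mul_sum]
    refine Finset.sum_congr rfl fun k hk => ?_
    obtain ⟨hki, hkj⟩ := (Finset.mem_filter.1 hk).2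
    simp only [epsHat, Matrix.of_apply, if_neg hki.symm, if_neg hkj]
    rw [h.symm x hx k j hkj]
    ring
  have h3 : ∀ k, epsHat ε x k k = x (0, k) := fun k => by simp [epsHat, Point.r]
  have h4 : epsHat ε x i j = eps ε i j x := by simp [epsHat, hij]
  rw [hsplit, h2, h3, h3, h4, if_neg hij] at h1
  simp only [sDEps, Matrix.of_apply, ne_eq, hij, hij.symm, not_false_eq_true, if_true] at h1
  rw [h.epsD₁_eq_epsD₂ hx hij]
  linear_combination h1

end IsSmoothData
end SolitonGas

end

open SolitonGas in
theorem mainTheorem1 {n : ℕ}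
    (ε : Fin n → Fin n → ℝ → ℝ → ℝ) (s : Fin n → ℝ → ℝ) (g : Fin n → ℝ → ℝ → ℝ) (c : ℝ)
    (U : Set (Point n)) (hU : IsOpen U)
    (hconn : ∀ (i : Fin n) (y : ℝ), IsPreconnected {ρ : ℝ | ∃ x ∈ U, x.r i = ρ ∧ x.eta i = y})
    (hsymm : ∀ x ∈ U, ∀ i j, i ≠ j → eps ε i j x = eps ε j i x)
    (hε : ∀ x ∈ U, ∀ i j, i ≠ j →
      ContDiffAt ℝ ∞ (fun p : ℝ × ℝ => ε i j p.1 p.2) (x.eta i, x.eta j))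
    (hs : ∀ x ∈ U, ∀ i, ContDiffAt ℝ ∞ (s i) (x.eta i))
    (hs0 : ∀ x ∈ U, ∀ i, s i (x.eta i) ≠ 0)
    (hg : ∀ x ∈ U, ∀ i, ContDiffAt ℝ ∞ (fun p : ℝ × ℝ => g i p.1 p.2) (x.r i, x.eta i))
    (hcurv : HasConstantCurvatureOn (metric ε s g) c (U ∩ regularLocus ε)) :
    ∃ φ χ ψ : Fin n → ℝ → ℝ,
      (∀ x ∈ U, ∀ i, g i (x.r i) (x.eta i) =
        φ i (x.eta i) * x.r i ^ 2 + χ i (x.eta i) * x.r i + ψ i (x.eta i)) ∧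
      (∀ x ∈ U, ∀ i j, i ≠ j →
        eps ε i j x * (χ i (x.eta i) + χ j (x.eta j)) - 2 * c =
          2 * (s i (x.eta i) * epsD₁ ε i j x + s j (x.eta j) * epsD₂ ε i j x
            + ∑ k with k ≠ i ∧ k ≠ j, eps ε i k x * eps ε j k x * φ k (x.eta k))) ∧
      (∀ x ∈ U, ∀ i,
        (∑ k with k ≠ i, φ k (x.eta k) * eps ε i k x ^ 2) + ψ i (x.eta i) = -c) := by
  have h : IsSmoothData ε s g U := ⟨hU, hsymm, hε, hs, hs0, hg⟩
  have hφ := fun {x} (hx : x ∈ U) i => h.quadCoeff_eq hconn hcurv hx i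
  have hχ := fun {x} (hx : x ∈ U) i => h.linCoeff_eq hconn hcurv hx i
  have hψ := fun {x} (hx : x ∈ U) i => h.constCoeff_eq hconn hcurv hx i
  refine ⟨IsSmoothData.quadCoeff g U, IsSmoothData.linCoeff g U, IsSmoothData.constCoeff g U,
    fun x hx i => ?_, fun x hx i j hij => ?_, fun x hx i => ?_⟩
  -- After the coefficients are rewritten at x itself, the quadratic formula for g_i is an algebraic
  -- identity.
  · simp only [Point.r, Point.eta, hφ hx, hχ hx, hψ hx]
    ring
  · simp only [Point.eta, hφ hx, hχ hx]
    linear_combination (-2) * h.structure_eq_offDiag hcurv hx hij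
  · simp only [Point.eta, hφ hx, hψ hx]
    linear_combination h.structure_eq_diag hcurv hx i
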